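/- Let $u_1,u_0$ be complex-valued functions of $x$ and of the times $s=(s_1,s_2,\dots)$ such that, for every $s$, $u_1(\cdot,s)$ and $u_0(\cdot,s)$ are $C^\infty$ on an open set $U_s\subset\mathbb{R}$, and let $$\mathcal{L}=\partial_x^3+u_1\partial_x+u_0 .$$ *Hierarchy.* In the ring of formal pseudo-differential operators $\sum_{i\le m} r_i(x)\partial_x^i$ with product determined by $\partial_x^a\cdot r=\sum_{l\ge0}\binom{a}{l}r^{(l)}\partial_x^{a-l}$ ($a\in\mathbb{Z}$), let $\mathcal{L}^{1/3}=\partial_x+\sum_{i\le0}p_i(x)\partial_x^i$ be the cube root of $\mathcal{L}$, put $\mathcal{L}^{m/3}=(\mathcal{L}^{1/3})^m$, and let $R_+$ denote the part of $R$ with nonnegative powers of $\partial_x$. The Boussinesq hierarchy consists of the equations $$\frac{\partial \mathcal{L}}{\partial s_m}=\left[(\mathcal{L}^{m/3})_+,\mathcal{L}\right],\qquad m=1,2,3,\dots \tag{1}$$ *Hadamard coefficients.* Let $A(z)=\frac{1}{2\pi i}\int_{c-i\infty}^{c+i\infty}e^{z\xi+\xi^3}\,d\xi$ with $c>0$ (so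 that $A(z)=3^{-1/3}\mathrm{Ai}(-3^{-1/3}z)$). For each $s$ let $H_k^j(x,y)$, $k\ge1$, $j\in\{0,1\}$, be the Hadamard coefficients of the heat equation $\partial_t v=\mathcal{L}v$, i.e. functions that are $C^\infty$ in a neighborhood of the diagonal $y=x$ of $U_s\times U_s$ and such that, for fixed $y$, $$t^{-1/3}A\!\left(\tfrac{x-y}{t^{1/3}}\right)+\sum_{j=0}^{1}t^{-(j+1)/3}A^{(j)}\!\left(\tfrac{x-y}{t^{1/3}}\right)\sum_{k=1}^{\infty}H_k^j(x,y)t^k$$ is a formal solution of $\partial_tv=\mathcal{L}v$ for $t>0$; that is, for every $n\ge 0$, substituting the expansion truncated after $t^n$ into $\partial_t v-\mathcal{L}v$ leaves, near the diagonal, only a combination of the functions $t^{n-(j+1)/3}A^{(j)}\big((x-y)/t^{1/3}\big)$, $j=0,1$, with coefficients independent of $t$. Write $(a)_k=a(a+1)\cdots(a+k-1)$. Then the Boussinesq hierarchy (1) is equivalent, flow by flow, to the following equations. For every $k\ge1$ and every $s$: (a) equation (1) with $m=3k-2$ holds at $s$ if and only if, for all $x\in U_s$, $$\frac{\partial u_1}{\partial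 s_{3k-2}}=3\,(1/3)_k\,\frac{\partial}{\partial x}H_k^1(x,x),\qquad \frac{\partial u_0}{\partial s_{3k-2}}=3\,(1/3)_k\,\frac{\partial}{\partial x}\left[H_k^0(x,x)+\frac{\partial H_k^1(x,y)}{\partial x}\Big|_{y=x}\right];$$ (b) equation (1) with $m=3k-1$ holds at $s$ if and only if, for all $x\in U_s$, $$\frac{\partial u_1}{\partial s_{3k-1}}=3\,(2/3)_k\,\frac{\partial}{\partial x}H_k^0(x,x),\qquad \frac{\partial u_0}{\partial s_{3k-1}}=3\,(2/3)_k\,\frac{\partial}{\partial x}\left[\frac{\partial H_k^0(x,y)}{\partial x}\Big|_{y=x}\right];$$ (c) equation (1) with $m=3k$ holds at $s$ if and only if $\partial u_1/\partial s_{3k}=\partial u_0/\partial s_{3k}=0$ for all $x\in U_s$. -/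

import Mathlib

noncomputable section

namespace Boussinesq

/-! ### Formal pseudo-differential operators -/

/-- The formal pseudo-differential operator `∑_{i ≥ 0} coeff i (x) ∂_x ^ (order - i)`.
The leading coefficient may vanish, so `order` is only an upper bound. -/
structure PsiDO where
  order : ℤ
  coeff : ℕ → ℝ → ℂ

namespace PsiDO

/-- The coefficient of `∂_x ^ n`, for `n : ℤ`. -/
def coeffAt (P : PsiDO) (n : ℤ) (x : ℝ) : ℂ :=
  if n ≤ P.order then P.coeff (P.order - n).toNat x else 0

/-- The product, determined by the Leibniz rule
`∂_x ^ a · r = ∑_{l ≥ 0} (a choose l) r^(l) ∂_x ^ (a - l)` for `a : ℤ`. -/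
def mul (P Q : PsiDO) : PsiDO where
  order := P.order + Q.order
  coeff n x := ∑ p ∈ Finset.HasAntidiagonal.antidiagonal n, ∑ q ∈ Finset.HasAntidiagonal.antidiagonal p.2,
    P.coeff p.1 x * ((Ring.choose (P.order - (p.1 : ℤ)) q.1 : ℤ) : ℂ) *
      iteratedDeriv q.1 (Q.coeff q.2) x

/-- The identity operator. -/
def one : PsiDO where
  order := 0
  coeff i _ := if i = 0 then 1 else 0

/-- Natural powers. -/
def pow (P : PsiDO) : ℕ → PsiDO
  | 0 => one
  | m + 1 => mul (pow P m) P

/-- The differential operator part: the terms with nonnegative powers of `∂_x`. -/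
def posPart (P : PsiDO) : PsiDO where
  order := P.order
  coeff i x := if (i : ℤ) ≤ P.order then P.coeff i x else 0

/-- The coefficient of `∂_x ^ n` in the commutator `[P, Q] = P Q - Q P`. -/
def commCoeff (P Q : PsiDO) (n : ℤ) (x : ℝ) : ℂ :=
  (mul P Q).coeffAt n x - (mul Q P).coeffAt n x

/-- On the open set `U`, `P` is the cube root of `L`: it has the form
`∂_x + ∑_{i ≤ 0} p_i(x) ∂_x ^ i` with smooth coefficients, and `P ^ 3 = L`. -/
structure IsCubeRoot (U : Set ℝ) (P L : PsiDO) : Prop where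
  order_eq : P.order = 1
  monic : ∀ x ∈ U, P.coeff 0 x = 1
  smooth : ∀ i, ContDiffOn ℝ (⊤ : ℕ∞) (P.coeff i) U
  cube : ∀ n : ℤ, ∀ x ∈ U, (pow P 3).coeffAt n x = L.coeffAt n x

end PsiDO

/-- The operator `∂_x ^ 3 + u₁(x) ∂_x + u₀(x)`. -/
def opL (u₁ u₀ : ℝ → ℂ) : PsiDO where
  order := 3
  coeff i x := if i = 0 then 1 else if i = 2 then u₁ x else if i = 3 then u₀ x else 0

/-- The action of `∂_x ^ 3 + u₁(x) ∂_x + u₀(x)` on a function. -/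
def applyL (u₁ u₀ : ℝ → ℂ) (v : ℝ → ℂ) (x : ℝ) : ℂ :=
  iteratedDeriv 3 v x + u₁ x * deriv v x + u₀ x * v x

/-! ### The Gelfand-Dickey flows for `N = 3`

The times are `s = (s_1, s_2, …)`, as a function on `ℕ` (the entry `s 0` plays no role), and the
coefficients are `u_j(s, x)`. For the times `s`, the variable `x` ranges over
`{x | (x, s) ∈ Ω}`. -/

/-- The space domain at the times `s`. -/
def slice (Ω : Set (ℝ × (ℕ → ℝ))) (s : ℕ → ℝ) : Set ℝ := {x | (x, s) ∈ Ω}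

/-- `∂ f / ∂ s_m = a` at the times `s`; this includes that the partial derivative exists. -/
def HasTimeDeriv (f : (ℕ → ℝ) → ℂ) (m : ℕ) (s : ℕ → ℝ) (a : ℂ) : Prop :=
  HasDerivAt (fun τ : ℝ => f (Function.update s m τ)) a (s m)

/-- The equation `∂ L / ∂ s_m = [(L ^ (m / 3))_+, L]` at the times `s`: equality of the
coefficients of all powers of `∂_x`, where `L ^ (m / 3) = P ^ m` for the cube root `P` of `L`. -/
def GelfandDickeyFlow (Ω : Set (ℝ × (ℕ → ℝ))) (u₁ u₀ : (ℕ → ℝ) → ℝ → ℂ) (m : ℕ)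
    (s : ℕ → ℝ) : Prop :=
  ∃ P : PsiDO, PsiDO.IsCubeRoot (slice Ω s) P (opL (u₁ s) (u₀ s)) ∧
    ∀ x ∈ slice Ω s, ∀ n : ℤ,
      HasTimeDeriv (fun s' => (opL (u₁ s') (u₀ s')).coeffAt n x) m s
        (PsiDO.commCoeff (P.pow m).posPart (opL (u₁ s) (u₀ s)) n x)

/-! ### The heat kernel -/

/-- The Airy-type function
`A_3(z; 1) = (1 / (2 π i)) ∫_{c - i ∞}^{c + i ∞} exp (z ξ + ξ ^ 3) dξ`, `c > 0`, which does not
depend on `c`; here `c = 1` and `ξ = 1 + i η`. -/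
def airyA (z : ℝ) : ℂ :=
  (1 / (2 * (Real.pi : ℂ))) *
    ∫ η : ℝ, Complex.exp ((z : ℂ) * (1 + Complex.I * (η : ℂ)) + (1 + Complex.I * (η : ℂ)) ^ 3)

/-- The function `t ^ (- (j + 1) / 3) A_3^(j) ((x - y) / t ^ (1 / 3))`. -/
def airyTerm (j : Fin 2) (x y t : ℝ) : ℂ :=
  ((t ^ (-(((j : ℕ) : ℝ) + 1) / 3) : ℝ) : ℂ) *
    iteratedDeriv (j : ℕ) airyA ((x - y) / t ^ ((1 : ℝ) / 3))

/-- The heat kernel expansion with coefficients `H k j (x, y) = H_k^j(x, y)`, `k ≥ 1`,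
truncated after `t ^ n`. -/
def heatPartialSum (H : ℕ → Fin 2 → ℝ → ℝ → ℂ) (n : ℕ) (x y t : ℝ) : ℂ :=
  airyTerm 0 x y t +
    ∑ j : Fin 2, airyTerm j x y t * ∑ k ∈ Finset.Icc 1 n, H k j x y * (t : ℂ) ^ k

/-- `H k j`, for `k ≥ 1` and `j ∈ {0, 1}`, are the Hadamard coefficients of the heat equation
`∂_t v = L v`, `L = ∂_x ^ 3 + u₁ ∂_x + u₀`, on the open set `U`: they are smooth near the diagonal
of `U × U`, and the heat kernel expansion is a formal solution. The latter says that, for every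
`n`, if the expansion truncated after `t ^ n` is substituted into the equation, then the terms
with `t ^ k`, `k < n`, cancel, and only a combination of the two functions
`t ^ (- (j + 1) / 3) A_3^(j) ((x - y) / t ^ (1 / 3)) t ^ n` is left. -/
def IsHadamard (U : Set ℝ) (u₁ u₀ : ℝ → ℂ) (H : ℕ → Fin 2 → ℝ → ℝ → ℂ) : Prop :=
  ∀ n : ℕ, ∃ V : Set (ℝ × ℝ), IsOpen V ∧ (∀ x ∈ U, (x, x) ∈ V) ∧
    (∀ k ∈ Finset.Icc 1 n, ∀ j : Fin 2,
      ContDiffOn ℝ (⊤ : ℕ∞) (fun p : ℝ × ℝ => H k j p.1 p.2) V) ∧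
    ∃ r : Fin 2 → ℝ → ℝ → ℂ, ∀ x y : ℝ, (x, y) ∈ V → ∀ t : ℝ, 0 < t →
      deriv (fun τ => heatPartialSum H n x y τ) t -
          applyL u₁ u₀ (fun ξ => heatPartialSum H n ξ y t) x =
        ∑ j : Fin 2, r j x y * airyTerm j x y t * (t : ℂ) ^ n

/-- The Pochhammer symbol `(a)_k = a (a + 1) ⋯ (a + k - 1)`. -/
def poch (a : ℂ) (k : ℕ) : ℂ := (ascPochhammer ℂ k).eval a

/-- The value on the diagonal, `h(x, x)`. -/
def diag (h : ℝ → ℝ → ℂ) (x : ℝ) : ℂ := h x x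

/-- The first `x`-derivative on the diagonal, `∂ h(x, y) / ∂ x` at `y = x`. -/
def diagDx (h : ℝ → ℝ → ℂ) (x : ℝ) : ℂ := deriv (fun ξ => h ξ x) x

end Boussinesq

end

open Boussinesq

/-! ### Products of formal pseudo-differential operators over a differential ring -/

noncomputable section

namespace Boussinesq

open PowerSeries Finset

/-! The flow sees only two residues. Let `P` be the cube root of `L`. Since `P ^ m` commutes with
`L`, the commutator of its positive part with `L` is minus that of its negative part. The first is a
differential operator and the second has order at most 1, so only `∂` and `1` occur. Their
coefficients are `3 ρ₁'` and `3 ρ₂'`, with `ρ₁` the coefficient of `∂⁻¹` in `P ^ m` and `ρ₂` equal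
to `ρ₁'` plus the coefficient of `∂⁻²` (`coeff_comm_posPart`, `gelfandDickeyFlow_iff`). It remains
to compute `ρ₁, ρ₂` at each point `y`, and for that all functions are replaced by their Taylor
series in `z = x - y`.

The Hadamard expansion is, formally, `∫ G(z, ξ) exp (z ξ + t ξ³) dξ`: `A` and `A'` correspond to `1`
and `ξ`, and integration by parts turns multiplication by `t` into `D = -(1/3) (∂_ξ + z) ξ⁻²`. Hence
`G = ∑ D ^ l (a_l + b_l ξ)`, where `a_l, b_l` are the jets of `H_l^0, H_l^1`. The Hadamard recursion
says exactly `L (G exp (z ξ)) = ξ³ G exp (z ξ)` (`HadamardRec.symL_hadamardSym`), so `G` is the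
symbol of a monic operator `W` of order 0 with `L W = W ∂³`. Uniqueness of monic cube roots gives `P
W = W ∂`, hence `P ^ m W = W ∂ ^ m`.

Such a `W` is far from unique, but this one is normalized: at `z = 0` the residues in `ξ` of all
`∂_z ^ k (G exp (z ξ))` vanish. Indeed, at `z = 0` the residue of `ξ ^ m D f` is `m / 3` times that
of `ξ ^ (m - 3) f`, which is zero for `m = 0`. The normalization allows `W ∂ ^ m` to replace `P ^ m
= W ∂ ^ m W⁻¹` in computing residues at `z = 0` (`symRes_toSym_seqPow`). Iterating the rule for `D`
then produces the factors `∏ (m / 3 - i)`, i.e. the Pochhammer symbols, and the residue class of `m`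
modulo 3 selects `b_k`, `a_k` or nothing.

On the analytic side, the recursion must be read off from the formal-solution property. This needs
the equation `A'' = -(z / 3) A` and the linear independence of `A` and `A'` over the polynomials
(`polynomial_eq_zero_of_airy`), which separates powers of `t` when `x ≠ y`; continuity then gives
the diagonal. -/

theorem sum_range_antidiagonal {M : Type*} [AddCommMonoid M] (N : ℕ) (G : ℕ → ℕ → M)
    (hG : ∀ i j, N ≤ i + j → G i j = 0) :
    ∑ k ∈ range N, ∑ q ∈ antidiagonal k, G q.1 q.2 =
      ∑ i ∈ range N, ∑ j ∈ range N, G i j := by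
  rw [← Finset.sum_product' (range N) (range N) G, Finset.sum_sigma']
  refine Finset.sum_bij_ne_zero (fun x _ _ => x.2) ?_ ?_ ?_ ?_
  · rintro ⟨k, i, j⟩ h _
    simp only [mem_sigma, mem_range, HasAntidiagonal.mem_antidiagonal] at h
    simp only [mem_product, mem_range]; omega
  · rintro ⟨k, i, j⟩ h _ ⟨k', i', j'⟩ h' _ e
    simp only [mem_sigma, mem_range, HasAntidiagonal.mem_antidiagonal] at h h'
    simp only [Prod.mk.injEq] at e
    obtain ⟨rfl, rfl⟩ := e
    obtain ⟨_, rfl⟩ := h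
    obtain ⟨_, rfl⟩ := h'
    rfl
  · rintro ⟨i, j⟩ h hne
    refine ⟨⟨i + j, i, j⟩, ?_, hne, rfl⟩
    simp only [mem_sigma, mem_range, HasAntidiagonal.mem_antidiagonal, and_true]
    by_contra hc
    exact hne (hG i j (by omega))
  · intro x _ _; rfl

theorem sum_antidiagonal_antidiagonal_eq {M : Type*} [AddCommMonoid M] (n : ℕ)
    (F : ℕ → ℕ → ℕ → M) :
    ∑ x ∈ antidiagonal n, ∑ y ∈ antidiagonal x.2, F x.1 y.1 y.2 =
      ∑ l ∈ range (n + 1), ∑ x ∈ antidiagonal (n - l), F x.1 l x.2 := by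
  rw [Finset.sum_sigma', Finset.sum_sigma']
  refine Finset.sum_bij' (fun x _ => ⟨x.2.1, x.1.1, x.2.2⟩)
    (fun x _ => ⟨(x.2.1, x.1 + x.2.2), x.1, x.2.2⟩) ?_ ?_ ?_ ?_ ?_
  · rintro ⟨⟨i, m⟩, l, j⟩ h
    simp only [mem_sigma, mem_range, HasAntidiagonal.mem_antidiagonal] at h ⊢
    omega
  · rintro ⟨l, i, j⟩ h
    simp only [mem_sigma, mem_range, HasAntidiagonal.mem_antidiagonal, and_true] at h ⊢
    obtain ⟨h₁, h₂⟩ := h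
    omega
  · rintro ⟨⟨i, m⟩, l, j⟩ h
    simp only [mem_sigma, HasAntidiagonal.mem_antidiagonal] at h
    obtain ⟨_, rfl⟩ := h
    rfl
  · rintro ⟨l, i, j⟩ h
    rfl
  · intros; rfl

variable {R : Type*} [CommRing R] (δ : R →+ R)

theorem iterate_mul_of_leibniz {A : Type*} [CommRing A] (D : A →+ A)
    (hD : ∀ p q, D (p * q) = D p * q + p * D q) (n : ℕ) (p q : A) :
    D^[n] (p * q) = ∑ x ∈ antidiagonal n, (n.choose x.1 : A) * (D^[x.1] p * D^[x.2] q) := by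
  induction n with
  | zero => simp
  | succ n ih =>
    rw [Finset.sum_antidiagonal_choose_succ_mul (fun i j => D^[i] p * D^[j] q),
      Function.iterate_succ_apply', ih, map_sum, ← Finset.sum_add_distrib]
    refine Finset.sum_congr rfl fun x hx => ?_
    have : n.choose x.2 = n.choose x.1 := by
      rw [← Nat.choose_symm_of_eq_add]
      rw [HasAntidiagonal.mem_antidiagonal] at hx; omega
    rw [this, ← nsmul_eq_mul, map_nsmul, hD, nsmul_eq_mul, Function.iterate_succ_apply',
      Function.iterate_succ_apply']
    ring

/-- The coefficientwise action of a derivation on power series. -/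
def coeffDeriv : R⟦X⟧ →+ R⟦X⟧ where
  toFun p := PowerSeries.mk fun n => δ (coeff n p)
  map_zero' := by ext; simp
  map_add' p q := by ext; simp

@[simp] theorem coeff_coeffDeriv (p : R⟦X⟧) (n : ℕ) :
    coeff n (coeffDeriv δ p) = δ (coeff n p) := by
  simp [coeffDeriv]

theorem coeffDeriv_mul (hδ : ∀ r s, δ (r * s) = δ r * s + r * δ s) (p q : R⟦X⟧) :
    coeffDeriv δ (p * q) = coeffDeriv δ p * q + p * coeffDeriv δ q := by
  ext n
  simp only [coeff_coeffDeriv, map_add, coeff_mul, map_sum, ← sum_add_distrib, hδ]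

@[simp] theorem coeff_iterate_coeffDeriv (l : ℕ) (p : R⟦X⟧) (n : ℕ) :
    coeff n ((coeffDeriv δ)^[l] p) = δ^[l] (coeff n p) := by
  induction l generalizing p with
  | zero => rfl
  | succ l ih => rw [Function.iterate_succ_apply', coeff_coeffDeriv, ih,
      Function.iterate_succ_apply']

theorem iterate_coeffDeriv_X_pow_mul (l k : ℕ) (p : R⟦X⟧) :
    (coeffDeriv δ)^[l] (X ^ k * p) = X ^ k * (coeffDeriv δ)^[l] p := by
  ext n
  simp only [coeff_iterate_coeffDeriv, coeff_X_pow_mul']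
  split_ifs
  · rfl
  · exact iterate_map_zero δ l

/-- Multiplication of the coefficient of `X ^ i` by the binomial coefficient `(a - i choose l)`. -/
def binomScale (a : ℤ) (l : ℕ) : R⟦X⟧ →ₗ[R] R⟦X⟧ where
  toFun p := PowerSeries.mk fun i => (Ring.choose (a - i) l : ℤ) * coeff i p
  map_add' p q := by ext; simp [mul_add]
  map_smul' c p := by ext; simp [mul_left_comm]

@[simp] theorem coeff_binomScale (a : ℤ) (l : ℕ) (p : R⟦X⟧) (i : ℕ) :
    coeff i (binomScale a l p) = (Ring.choose (a - i) l : ℤ) * coeff i p := by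
  simp [binomScale]

theorem binomScale_X_pow_mul (a : ℤ) (l k : ℕ) (p : R⟦X⟧) :
    binomScale a l (X ^ k * p) = X ^ k * binomScale (a - k) l p := by
  ext n
  simp only [coeff_binomScale, coeff_X_pow_mul']
  split_ifs with h
  · rw [Nat.cast_sub h]; congr 3; ring
  · simp

/-- Vandermonde's identity, applied to `a + b - n = (a - i) + (b - j)` for each splitting `i + j =
n`. -/
theorem binomScale_mul (a b : ℤ) (k : ℕ) (p q : R⟦X⟧) :
    binomScale (a + b) k (p * q) =
      ∑ x ∈ antidiagonal k, binomScale a x.1 p * binomScale b x.2 q := by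
  ext n
  simp only [coeff_binomScale, map_sum, coeff_mul, mul_sum]
  rw [Finset.sum_comm]
  refine Finset.sum_congr rfl fun x hx => ?_
  rw [HasAntidiagonal.mem_antidiagonal] at hx
  have : a + b - (n : ℤ) = (a - x.1) + (b - x.2) := by rw [← hx]; push_cast; ring
  rw [this, Ring.add_choose_eq k (Commute.all _ _), Int.cast_sum, Finset.sum_mul]
  refine Finset.sum_congr rfl fun y _ => ?_
  push_cast; ring

/-- This is `(c choose l) (c - l choose k) = (l + k choose l) (c choose l + k)`, coefficient by
coefficient. -/
theorem binomScale_binomScale (a : ℤ) (l k : ℕ) (p : R⟦X⟧) :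
    binomScale (a - l) k (binomScale a l p) = ((l + k).choose l : R⟦X⟧) * binomScale a (l + k) p := by
  ext n
  rw [← map_natCast (C (R := R)), coeff_C_mul]
  simp only [coeff_binomScale]
  have := Ring.choose_smul_choose (a - n) (Nat.le_add_right l k)
  rw [Nat.add_sub_cancel_left, nsmul_eq_mul] at this
  have e : a - (l : ℤ) - n = a - n - l := by ring
  rw [e, ← mul_assoc, ← mul_assoc, mul_comm ((Ring.choose (a - n - l) k : ℤ) : R), ← Int.cast_mul,
    ← this]
  push_cast; ring

/-- The product of `∑ p_i ∂ ^ (a - i)` with `∑ q_j ∂ ^ (b - j)`, as the sequence of coefficients of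
`∂ ^ (a + b - n)`; it does not depend on `b`. -/
def star (a : ℤ) (p q : R⟦X⟧) : R⟦X⟧ :=
  PowerSeries.mk fun n => ∑ x ∈ antidiagonal n, ∑ y ∈ antidiagonal x.2,
    coeff x.1 p * ((Ring.choose (a - (x.1 : ℤ)) y.1 : ℤ) : R) * δ^[y.1] (coeff y.2 q)

theorem coeff_star (a : ℤ) (p q : R⟦X⟧) (n : ℕ) :
    coeff n (star δ a p q) = ∑ x ∈ antidiagonal n, ∑ y ∈ antidiagonal x.2,
      coeff x.1 p * ((Ring.choose (a - (x.1 : ℤ)) y.1 : ℤ) : R) * δ^[y.1] (coeff y.2 q) :=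
  coeff_mk _ _

/-- Grouping by the number `l` of derivatives writes the product as `∑ X ^ l · (binomially scaled p)
· (δ ^ l q)` with commutative products of power series. The coefficient at `n` sees only `l ≤ n`, so
any longer finite sum serves in place of the infinite one. -/
theorem coeff_star_eq_sum_range (a : ℤ) (p q : R⟦X⟧) {n N : ℕ} (h : n < N) :
    coeff n (star δ a p q) =
      coeff n (∑ l ∈ range N, X ^ l * (binomScale a l p * (coeffDeriv δ)^[l] q)) := by
  rw [coeff_star, sum_antidiagonal_antidiagonal_eq n (fun i l j =>
    coeff i p * ((Ring.choose (a - (i : ℤ)) l : ℤ) : R) * δ^[l] (coeff j q)), map_sum]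
  have hs : range (n + 1) ⊆ range N := by
    intro x; simp only [mem_range]; omega
  rw [← Finset.sum_subset hs]
  · refine Finset.sum_congr rfl fun l hl => ?_
    rw [mem_range] at hl
    rw [coeff_X_pow_mul', if_pos (by omega), coeff_mul]
    refine Finset.sum_congr rfl fun x _ => ?_
    rw [coeff_binomScale, coeff_iterate_coeffDeriv]; ring
  · intro l _ hl
    rw [mem_range] at hl
    rw [coeff_X_pow_mul', if_neg (by omega)]

theorem star_add_left (a : ℤ) (p p' q : R⟦X⟧) :
    star δ a (p + p') q = star δ a p q + star δ a p' q := by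
  ext n; simp only [coeff_star, map_add, add_mul, sum_add_distrib]

theorem star_add_right (a : ℤ) (p q q' : R⟦X⟧) :
    star δ a p (q + q') = star δ a p q + star δ a p q' := by
  ext n; simp only [coeff_star, map_add, iterate_map_add, mul_add, sum_add_distrib]

@[simp] theorem star_zero_right (a : ℤ) (p : R⟦X⟧) : star δ a p 0 = 0 := by
  ext n; simp [coeff_star, iterate_map_zero]

theorem star_sum_right {ι : Type*} (s : Finset ι) (a : ℤ) (p : R⟦X⟧) (q : ι → R⟦X⟧) :
    star δ a p (∑ i ∈ s, q i) = ∑ i ∈ s, star δ a p (q i) := by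
  classical
  induction s using Finset.induction_on with
  | empty => simp
  | insert i s hi ih => rw [sum_insert hi, star_add_right, ih, sum_insert hi]

theorem star_X_pow_mul_right (a : ℤ) (k : ℕ) (p q : R⟦X⟧) :
    star δ a p (X ^ k * q) = X ^ k * star δ a p q := by
  ext n
  rw [coeff_star_eq_sum_range δ a p _ n.lt_succ_self]
  have : ∑ l ∈ range (n + 1), X ^ l * (binomScale a l p * (coeffDeriv δ)^[l] (X ^ k * q)) =
      X ^ k * ∑ l ∈ range (n + 1), X ^ l * (binomScale a l p * (coeffDeriv δ)^[l] q) := by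
    rw [mul_sum]
    refine Finset.sum_congr rfl fun l _ => ?_
    rw [iterate_coeffDeriv_X_pow_mul]; ring
  rw [this, coeff_X_pow_mul', coeff_X_pow_mul']
  split_ifs
  · rw [coeff_star_eq_sum_range δ a p q (show n - k < n + 1 by omega)]
  · rfl

/-- A factor `X ^ k` lowers the order by `k`. On the left it shifts the exponents entering the
binomial coefficients, hence the change from `a` to `a - k`; on the right it has no such effect. -/
theorem star_X_pow_mul_left (a : ℤ) (k : ℕ) (p q : R⟦X⟧) :
    star δ a (X ^ k * p) q = X ^ k * star δ (a - k) p q := by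
  ext n
  rw [coeff_star_eq_sum_range δ a _ q n.lt_succ_self]
  have : ∑ l ∈ range (n + 1), X ^ l * (binomScale a l (X ^ k * p) * (coeffDeriv δ)^[l] q) =
      X ^ k * ∑ l ∈ range (n + 1), X ^ l * (binomScale (a - k) l p * (coeffDeriv δ)^[l] q) := by
    rw [mul_sum]
    refine Finset.sum_congr rfl fun l _ => ?_
    rw [binomScale_X_pow_mul]; ring
  rw [this, coeff_X_pow_mul', coeff_X_pow_mul']
  split_ifs
  · rw [coeff_star_eq_sum_range δ (a - k) p q (show n - k < n + 1 by omega)]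
  · rfl

theorem coeff_star_congr {a : ℤ} {p p' q q' : R⟦X⟧} {n : ℕ}
    (hp : ∀ i ≤ n, coeff i p = coeff i p') (hq : ∀ i ≤ n, coeff i q = coeff i q') :
    coeff n (star δ a p q) = coeff n (star δ a p' q') := by
  simp only [coeff_star]
  refine Finset.sum_congr rfl fun x hx => Finset.sum_congr rfl fun y hy => ?_
  rw [HasAntidiagonal.mem_antidiagonal] at hx hy
  rw [hp _ (by omega), hq _ (by omega)]

/-- Both bracketings expand into the same triple sum of the terms `F l i j`: `l` derivatives fall on
`q`, and `i + j` on `s`. The left side reaches it by `binomScale_mul` and `binomScale_binomScale`,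
the right side by the Leibniz rule for iterated derivatives. -/
theorem star_assoc (hδ : ∀ r s, δ (r * s) = δ r * s + r * δ s) (a b : ℤ) (p q s : R⟦X⟧) :
    star δ (a + b) (star δ a p q) s = star δ a p (star δ b q s) := by
  ext n
  set N := n + 1 with hN
  let F : ℕ → ℕ → ℕ → R⟦X⟧ := fun l i j => X ^ (l + i + j) * (((l + i).choose l : R⟦X⟧) *
    (binomScale a (l + i) p * binomScale b j ((coeffDeriv δ)^[l] q) * (coeffDeriv δ)^[i + j] s))
  have hF : ∀ l i j, N ≤ l + i + j → coeff n (F l i j) = 0 := by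
    intro l i j h
    rw [coeff_X_pow_mul', if_neg (by omega)]
  have h₁ : coeff n (star δ (a + b) (star δ a p q) s) =
      ∑ l ∈ range N, ∑ i ∈ range N, ∑ j ∈ range N, coeff n (F l i j) := by
    rw [coeff_star_congr δ (p' := ∑ l ∈ range N, X ^ l * (binomScale a l p * (coeffDeriv δ)^[l] q))
      (q' := s) (fun i hi => coeff_star_eq_sum_range δ a p q (by omega)) (fun _ _ => rfl),
      coeff_star_eq_sum_range δ _ _ _ (show n < N by omega)]
    have : ∀ k, X ^ k * (binomScale (a + b) k
        (∑ l ∈ range N, X ^ l * (binomScale a l p * (coeffDeriv δ)^[l] q)) * (coeffDeriv δ)^[k] s) =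
        ∑ l ∈ range N, ∑ x ∈ antidiagonal k, F l x.1 x.2 := by
      intro k
      rw [map_sum, sum_mul, mul_sum]
      refine Finset.sum_congr rfl fun l _ => ?_
      rw [binomScale_X_pow_mul, show a + b - (l : ℤ) = (a - l) + b by ring, binomScale_mul,
        mul_sum, sum_mul, mul_sum]
      refine Finset.sum_congr rfl fun x hx => ?_
      rw [HasAntidiagonal.mem_antidiagonal] at hx
      rw [binomScale_binomScale, ← hx]
      simp only [F]
      rw [add_assoc l, pow_add X l]
      ring
    simp only [this]
    simp only [map_sum]
    rw [Finset.sum_comm]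
    refine Finset.sum_congr rfl fun l _ => ?_
    exact sum_range_antidiagonal N (fun i j => coeff n (F l i j)) fun i j h => hF l i j (by omega)
  have h₂ : coeff n (star δ a p (star δ b q s)) =
      ∑ l ∈ range N, ∑ i ∈ range N, ∑ j ∈ range N, coeff n (F l i j) := by
    rw [coeff_star_congr δ (q' := ∑ l ∈ range N, X ^ l * (binomScale b l q * (coeffDeriv δ)^[l] s))
      (p' := p) (fun _ _ => rfl) (fun i hi => coeff_star_eq_sum_range δ b q s (by omega)),
      coeff_star_eq_sum_range δ _ _ _ (show n < N by omega)]
    have : ∀ r, X ^ r * (binomScale a r p *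
        (coeffDeriv δ)^[r] (∑ j ∈ range N, X ^ j * (binomScale b j q * (coeffDeriv δ)^[j] s))) =
        ∑ j ∈ range N, ∑ x ∈ antidiagonal r, F x.1 x.2 j := by
      intro r
      have hc : ∀ l j, (coeffDeriv δ)^[l] (binomScale b j q) =
          binomScale b j ((coeffDeriv δ)^[l] q) := by
        intro l j
        ext m
        simp only [coeff_iterate_coeffDeriv, coeff_binomScale]
        rw [← zsmul_eq_mul, iterate_map_zsmul, zsmul_eq_mul]
      rw [show (coeffDeriv δ)^[r] (∑ j ∈ range N, X ^ j * (binomScale b j q * (coeffDeriv δ)^[j] s)) =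
        ∑ j ∈ range N, (coeffDeriv δ)^[r] (X ^ j * (binomScale b j q * (coeffDeriv δ)^[j] s)) from by
          induction r with
          | zero => rfl
          | succ r ih => simp only [Function.iterate_succ_apply', ih, map_sum], mul_sum, mul_sum]
      refine Finset.sum_congr rfl fun j _ => ?_
      rw [iterate_coeffDeriv_X_pow_mul, iterate_mul_of_leibniz _ (coeffDeriv_mul δ hδ), mul_sum, mul_sum, mul_sum]
      refine Finset.sum_congr rfl fun x hx => ?_
      rw [HasAntidiagonal.mem_antidiagonal] at hx
      simp only [F]
      rw [hc, ← Function.iterate_add_apply, hx, ← hx, pow_add X _ j]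
      ring
    simp only [this]
    simp only [map_sum]
    rw [Finset.sum_comm]
    rw [Finset.sum_congr rfl fun j _ => sum_range_antidiagonal N (fun l i => coeff n (F l i j))
      fun l i h => hF l i j (by omega), Finset.sum_comm]
    exact Finset.sum_congr rfl fun l _ => Finset.sum_comm
  rw [h₁, h₂]

end Boussinesq

end

noncomputable section

/-! ### Symbols with values in formal power series -/

namespace Boussinesq

open PowerSeries Finset

/-- The formal derivative of complex power series. -/
def dz : ℂ⟦X⟧ →+ ℂ⟦X⟧ := (PowerSeries.derivative ℂ).toLinearMap.toAddMonoidHom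

theorem dz_mul (r s : ℂ⟦X⟧) : dz (r * s) = dz r * s + r * dz s := by
  change PowerSeries.derivative ℂ (r * s) =
    PowerSeries.derivative ℂ r * s + r * PowerSeries.derivative ℂ s
  rw [Derivation.leibniz, smul_eq_mul, smul_eq_mul]; ring

@[simp] theorem coeff_dz (r : ℂ⟦X⟧) (n : ℕ) : coeff n (dz r) = coeff (n + 1) r * (n + 1) :=
  coeff_derivative r n

@[simp] theorem dz_one : dz 1 = 0 := (PowerSeries.derivative ℂ).map_one_eq_zero

@[simp] theorem dz_X : dz X = 1 := PowerSeries.derivative_X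

theorem dz_smul (c : ℂ) (r : ℂ⟦X⟧) : dz (c • r) = c • dz r :=
  (PowerSeries.derivative ℂ).map_smul c r

/-- `symT` is the action `∂_z + ξ` of `∂_z` on symbols `∑ f n ξ ^ n`, seen as amplitudes
of `exp (z ξ)`. -/
def symT : Module.End ℂ (ℤ → ℂ⟦X⟧) where
  toFun f n := dz (f n) + f (n - 1)
  map_add' f g := by ext1 n; simp only [Pi.add_apply, map_add]; ring
  map_smul' c f := by
    ext1 n; simp only [Pi.smul_apply, dz_smul, smul_add, RingHom.id_apply]

/-- Multiplication of symbols by `ξ ^ m`. -/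
def symShift (m : ℤ) : Module.End ℂ (ℤ → ℂ⟦X⟧) where
  toFun f n := f (n - m)
  map_add' _ _ := rfl
  map_smul' _ _ := rfl

/-- The operator `- (1 / 3) (∂_ξ + z) ξ ^ (-2)`, by which multiplication by `t` acts on symbols
that are integrated against `exp (z ξ + t ξ ^ 3)`. -/
def symD : Module.End ℂ (ℤ → ℂ⟦X⟧) where
  toFun f n := (-(1 / 3) : ℂ) • (((n : ℂ) + 1) • f (n + 3) + X * f (n + 2))
  map_add' f g := by
    ext1 n; simp only [Pi.add_apply, mul_add, smul_add]; abel
  map_smul' c f := by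
    ext1 n
    simp only [Pi.smul_apply, mul_smul_comm, smul_add, RingHom.id_apply]
    rw [smul_comm c, smul_comm c, smul_comm c]

theorem symT_apply (f : ℤ → ℂ⟦X⟧) (n : ℤ) : symT f n = dz (f n) + f (n - 1) := rfl

theorem symShift_apply (m : ℤ) (f : ℤ → ℂ⟦X⟧) (n : ℤ) : symShift m f n = f (n - m) := rfl

theorem symD_apply (f : ℤ → ℂ⟦X⟧) (n : ℤ) :
    symD f n = (-(1 / 3) : ℂ) • (((n : ℂ) + 1) • f (n + 3) + X * f (n + 2)) := rfl

/-- `∂_ξ + z` and `∂_z + ξ` commute because the two cross brackets `[∂_ξ, ξ]` and `[z, ∂_z]` cancel.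
-/
theorem commute_symD_symT : Commute symD symT := by
  refine LinearMap.ext fun f => ?_
  ext1 n
  simp only [Module.End.mul_apply, symD_apply, symT_apply, dz_smul, map_add, dz_mul, dz_X, one_mul,
    mul_add, smul_add]
  rw [show n + 3 - 1 = n + 2 by ring, show n + 2 - 1 = n + 1 by ring, show n - 1 + 3 = n + 2 by ring,
    show n - 1 + 2 = n + 1 by ring]
  push_cast
  module

theorem commute_symShift_symT (m : ℤ) : Commute (symShift m) symT := by
  refine LinearMap.ext fun f => ?_
  ext1 n
  simp only [Module.End.mul_apply, symShift_apply, symT_apply]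
  rw [sub_right_comm]

theorem symD_pow_smul (l : ℕ) (r : ℂ⟦X⟧) (f : ℤ → ℂ⟦X⟧) :
    (symD ^ l) (r • f) = r • (symD ^ l) f := by
  induction l with
  | zero => rfl
  | succ l ih =>
    rw [pow_succ', Module.End.mul_apply, ih, Module.End.mul_apply]
    ext1 n
    simp only [symD_apply, Pi.smul_apply, smul_eq_mul, mul_smul_comm, mul_add]
    rw [mul_left_comm]

/-- The relation `[ξ³, D] = 1` mirrors `[∂_t, t] = 1`, as `ξ³` plays the role of `∂_t` and `D` that
of `t`. -/
theorem symShift_three_symD (f : ℤ → ℂ⟦X⟧) :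
    symShift 3 (symD f) = symD (symShift 3 f) + f := by
  ext1 n
  simp only [Pi.add_apply, symShift_apply, symD_apply]
  rw [show n - 3 + 3 = n by ring, show n - 3 + 2 = n - 1 by ring, show n + 3 - 3 = n by ring,
    show n + 2 - 3 = n - 1 by ring]
  push_cast
  module

theorem symShift_three_symD_pow (l : ℕ) (f : ℤ → ℂ⟦X⟧) :
    symShift 3 ((symD ^ (l + 1)) f) =
      (symD ^ (l + 1)) (symShift 3 f) + ((l : ℂ) + 1) • (symD ^ l) f := by
  induction l with
  | zero => simpa using symShift_three_symD f
  | succ l ih =>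
    have e : ∀ (j : ℕ) (g : ℤ → ℂ⟦X⟧), (symD ^ (j + 1)) g = symD ((symD ^ j) g) := fun j g => by
      rw [pow_succ', Module.End.mul_apply]
    rw [e (l + 1), symShift_three_symD, ih, map_add, map_smul, e (l + 1), e l f]
    push_cast
    module

theorem symT_pow_eq_zero {f : ℤ → ℂ⟦X⟧} {N : ℤ} (hf : ∀ n, N < n → f n = 0) (k : ℕ) :
    ∀ n, N + k < n → (symT ^ k) f n = 0 := by
  induction k with
  | zero => intro n hn; exact hf n (by simpa using hn)
  | succ k ih =>
    intro n hn
    push_cast at hn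
    rw [pow_succ', Module.End.mul_apply, symT_apply, ih n (by omega), ih (n - 1) (by omega)]
    simp

theorem symD_pow_eq_zero {f : ℤ → ℂ⟦X⟧} {N : ℤ} (hf : ∀ n, N < n → f n = 0) (l : ℕ) :
    ∀ n, N - 2 * l < n → (symD ^ l) f n = 0 := by
  induction l with
  | zero => intro n hn; exact hf n (by simpa using hn)
  | succ l ih =>
    intro n hn
    push_cast at hn
    rw [pow_succ', Module.End.mul_apply, symD_apply, ih (n + 3) (by omega), ih (n + 2) (by omega)]
    simp

/-- The value at `z = 0` of the residue in `ξ` of `∂_z ^ k (f exp (z ξ))`. -/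
def symRes (k : ℕ) (f : ℤ → ℂ⟦X⟧) : ℂ := constantCoeff ((symT ^ k) f (-1))

theorem symRes_add (k : ℕ) (f g : ℤ → ℂ⟦X⟧) : symRes k (f + g) = symRes k f + symRes k g := by
  simp [symRes]

theorem symRes_sum {ι : Type*} (k : ℕ) (s : Finset ι) (f : ι → ℤ → ℂ⟦X⟧) :
    symRes k (∑ i ∈ s, f i) = ∑ i ∈ s, symRes k (f i) := by
  simp [symRes]

/-- Since `symD` and the shift commute with `symT`, they may be applied last. At `z = 0` the summand
with factor `z` disappears, and extracting the coefficient of `ξ ^ (-1 - m)` from the `ξ`-derivative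
gives the factor `m / 3`. -/
theorem symRes_shift_symD (k : ℕ) (m : ℤ) (f : ℤ → ℂ⟦X⟧) :
    symRes k (symShift m (symD f)) = (m : ℂ) / 3 * symRes k (symShift (m - 3) f) := by
  have h₁ : (symT ^ k) (symShift m (symD f)) = symShift m (symD ((symT ^ k) f)) := by
    have := ((commute_symShift_symT m).mul_left commute_symD_symT).pow_right k
    exact (LinearMap.congr_fun this f).symm
  have h₂ : (symT ^ k) (symShift (m - 3) f) = symShift (m - 3) ((symT ^ k) f) :=
    (LinearMap.congr_fun ((commute_symShift_symT (m - 3)).pow_right k) f).symm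
  rw [symRes, symRes, h₁, h₂]
  simp only [symShift_apply, symD_apply]
  rw [show -1 - m + 3 = -1 - (m - 3) by ring]
  simp only [smul_add, map_add, map_mul, constantCoeff_X, zero_mul, smul_eq_C_mul, map_neg,
    constantCoeff_C, mul_zero, add_zero]
  push_cast
  ring

theorem symRes_shift_symD_pow (k l : ℕ) (m : ℤ) (f : ℤ → ℂ⟦X⟧) :
    symRes k (symShift m ((symD ^ l) f)) =
      (∏ i ∈ range l, ((m : ℂ) / 3 - i)) * symRes k (symShift (m - 3 * l) f) := by
  induction l generalizing f with
  | zero => simp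
  | succ l ih =>
    rw [pow_succ, Module.End.mul_apply, ih, symRes_shift_symD, Finset.prod_range_succ]
    have : m - 3 * ((l + 1 : ℕ) : ℤ) = m - 3 * l - 3 := by push_cast; ring
    rw [this]
    push_cast
    ring

/-! ### The symbol attached to Hadamard coefficients -/

/-- The symbol `a + b ξ`. -/
def linSym (a b : ℂ⟦X⟧) : ℤ → ℂ⟦X⟧ := fun n => if n = 0 then a else if n = 1 then b else 0

theorem linSym_eq_zero (a b : ℂ⟦X⟧) {n : ℤ} (h : 1 < n) : linSym a b n = 0 := by
  simp [linSym, show n ≠ 0 by omega, show n ≠ 1 by omega]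

/-- The partial sums of `∑ D ^ l (a_l + b_l ξ)`. -/
def hadamardPartial (a b : ℕ → ℂ⟦X⟧) (N : ℕ) : ℤ → ℂ⟦X⟧ :=
  ∑ l ∈ range N, (symD ^ l) (linSym (a l) (b l))

/-- The symbol `∑ D ^ l (a_l + b_l ξ)`. -/
def hadamardSym (a b : ℕ → ℂ⟦X⟧) : ℤ → ℂ⟦X⟧ := fun n => hadamardPartial a b (2 - n).toNat n

/-- `symD ^ l` lowers the `ξ`-degree by at least `2 l`, so each coefficient of the partial sums
stabilizes; the bound `2 - n` is merely a convenient one. -/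
theorem hadamardSym_eq_partial (a b : ℕ → ℂ⟦X⟧) {N : ℕ} {n : ℤ} (h : 2 - n ≤ N) :
    hadamardSym a b n = hadamardPartial a b N n := by
  simp only [hadamardSym, hadamardPartial, Finset.sum_apply]
  refine Finset.sum_subset (fun x hx => ?_) fun l _ hl => ?_
  · simp only [mem_range] at hx ⊢; omega
  · refine symD_pow_eq_zero (fun _ => linSym_eq_zero (a l) (b l)) l n ?_
    simp only [mem_range] at hl; omega

theorem symT_pow_congr {f g : ℤ → ℂ⟦X⟧} {N : ℤ} (h : ∀ n, N ≤ n → f n = g n) (k : ℕ) :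
    ∀ n, N + k ≤ n → (symT ^ k) f n = (symT ^ k) g n := by
  intro n hn
  have := symT_pow_eq_zero (f := f - g) (N := N - 1) (fun n hn => by
    rw [Pi.sub_apply, h n (by omega), sub_self]) k n (by omega)
  rw [map_sub, Pi.sub_apply, sub_eq_zero] at this
  exact this

theorem symRes_shift_hadamardSym (a b : ℕ → ℂ⟦X⟧) (k : ℕ) (m : ℤ) {N : ℕ} (hN : m + k + 3 ≤ N) :
    symRes k (symShift m (hadamardSym a b)) = ∑ l ∈ range N,
      (∏ i ∈ range l, ((m : ℂ) / 3 - i)) *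
        symRes k (symShift (m - 3 * l) (linSym (a l) (b l))) := by
  have : symRes k (symShift m (hadamardSym a b)) = symRes k (symShift m (hadamardPartial a b N)) := by
    refine congrArg constantCoeff (symT_pow_congr (N := -1 - k) (fun n hn => ?_) k _ (by omega))
    exact hadamardSym_eq_partial a b (by omega)
  rw [this, hadamardPartial, map_sum, symRes_sum]
  exact Finset.sum_congr rfl fun l _ => symRes_shift_symD_pow k l m _

/-- The action of `∂_z ^ 3 + u₁ ∂_z + u₀` on symbols. -/
def symL (u₁ u₀ : ℂ⟦X⟧) (f : ℤ → ℂ⟦X⟧) : ℤ → ℂ⟦X⟧ :=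
  (symT ^ 3) f + u₁ • symT f + u₀ • f

/-- The action of `∂_z ^ 3 + u₁ ∂_z + u₀` on power series. -/
def serL (u₁ u₀ v : ℂ⟦X⟧) : ℂ⟦X⟧ := dz (dz (dz v)) + u₁ * dz v + u₀ * v

/-- The recursion satisfied by the Taylor series of the Hadamard coefficients. -/
structure HadamardRec (u₁ u₀ : ℂ⟦X⟧) (a b : ℕ → ℂ⟦X⟧) : Prop where
  a_zero : a 0 = 1
  b_zero : b 0 = 0
  rec_a : ∀ k : ℕ, ((k : ℂ) + 1) • a (k + 1) + X * dz (a (k + 1)) + X * dz (dz (b (k + 1))) +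
    dz (b (k + 1)) + (1 / 3 : ℂ) • (X * (u₁ * b (k + 1))) = serL u₁ u₀ (a k)
  rec_b : ∀ k : ℕ, ((k : ℂ) + 1) • b (k + 1) + X * dz (b (k + 1)) =
    serL u₁ u₀ (b k) + 3 * dz (dz (a k)) + u₁ * a k

/-- The leading parts `ξ³ (a + b ξ)` cancel. What exceeds degree one in `ξ` is gathered as `ξ²`
times a linear symbol, the shape on which `symD` acts well. -/
theorem symL_linSym_sub (u₁ u₀ a b : ℂ⟦X⟧) :
    symL u₁ u₀ (linSym a b) - symShift 3 (linSym a b) =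
      linSym (serL u₁ u₀ a) (serL u₁ u₀ b + 3 * dz (dz a) + u₁ * a) +
      symShift 2 (linSym (3 * dz a + 3 * dz (dz b) + u₁ * b) (3 * dz b)) := by
  ext1 n
  simp only [symL, pow_succ, pow_zero, one_mul, Module.End.mul_apply, Pi.add_apply, Pi.sub_apply,
    Pi.smul_apply, symT_apply, symShift_apply, linSym, smul_eq_mul, serL]
  by_cases h0 : n = 0
  · subst h0; norm_num
  by_cases h1 : n = 1
  · subst h1; norm_num; ring
  by_cases h2 : n = 2
  · subst h2; norm_num; ring
  by_cases h3 : n = 3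
  · subst h3; norm_num; ring
  by_cases h4 : n = 4
  · subst h4; norm_num
  simp [h0, h1, show n - 1 ≠ 0 by omega, show n - 1 ≠ 1 by omega, show n - 2 ≠ 0 by omega,
    show n - 2 ≠ 1 by omega, show n - 1 - 1 ≠ 0 by omega, show n - 1 - 1 ≠ 1 by omega,
    show n - 1 - 1 - 1 ≠ 0 by omega, show n - 1 - 1 - 1 ≠ 1 by omega, show n - 3 ≠ 0 by omega,
    show n - 3 ≠ 1 by omega]

/-- Because `D` contains `ξ⁻²`, the overflow of level `l + 1` returns as a linear symbol at level
`l`. This is why two families of coefficients suffice. -/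
theorem symD_shift_two_linSym (c d : ℂ⟦X⟧) :
    symD (symShift 2 (linSym c d)) =
      (-(1 / 3) : ℂ) • linSym (X * c + d) (X * d) := by
  ext1 n
  simp only [symD_apply, symShift_apply, linSym, Pi.smul_apply]
  rw [show n + 3 - 2 = n + 1 by ring, show n + 2 - 2 = n by ring]
  by_cases h0 : n = 0
  · subst h0; norm_num; ring
  by_cases h1 : n = 1
  · subst h1; norm_num
  by_cases h2 : n = -1
  · subst h2; norm_num
  simp [h0, h1, show n + 1 ≠ 0 by omega]

/-- The sum telescopes: the remainder left at level `N` is cancelled by the overflow of level `N +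
1` together with the commutator term `(N + 1) D ^ N` from `symShift_three_symD_pow`. This
cancellation is precisely the recursion. -/
theorem HadamardRec.symL_partial {u₁ u₀ : ℂ⟦X⟧} {a b : ℕ → ℂ⟦X⟧} (h : HadamardRec u₁ u₀ a b)
    (N : ℕ) :
    symL u₁ u₀ (hadamardPartial a b (N + 1)) - symShift 3 (hadamardPartial a b (N + 1)) =
      (symD ^ N) (linSym (serL u₁ u₀ (a N)) (serL u₁ u₀ (b N) + 3 * dz (dz (a N)) + u₁ * a N)) := by
  have hadd : ∀ f g, symL u₁ u₀ (f + g) = symL u₁ u₀ f + symL u₁ u₀ g := by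
    intro f g; simp only [symL, map_add, smul_add]; abel
  have hD : ∀ l f, symL u₁ u₀ ((symD ^ l) f) = (symD ^ l) (symL u₁ u₀ f) := by
    intro l f
    have hc : ∀ k, (symT ^ k) ((symD ^ l) f) = (symD ^ l) ((symT ^ k) f) := fun k =>
      (LinearMap.congr_fun (commute_symD_symT.pow_pow l k) f).symm
    have h3 := hc 3
    have h1 := hc 1
    rw [pow_one] at h1
    simp only [symL, map_add, symD_pow_smul, h3, h1]
  induction N with
  | zero =>
    have := symL_linSym_sub u₁ u₀ (a 0) (b 0)
    simp only [hadamardPartial, zero_add, Finset.sum_range_one, pow_zero, Module.End.one_apply]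
    rw [this, h.a_zero, h.b_zero]
    simp only [dz_one, map_zero, mul_zero, add_zero]
    ext1 n
    simp [symShift_apply, linSym]
  | succ N ih =>
    rw [hadamardPartial, Finset.sum_range_succ, ← hadamardPartial, hadd, map_add, hD,
      symShift_three_symD_pow]
    have e := symL_linSym_sub u₁ u₀ (a (N + 1)) (b (N + 1))
    rw [sub_eq_iff_eq_add] at e ih
    have key : linSym (serL u₁ u₀ (a N)) (serL u₁ u₀ (b N) + 3 * dz (dz (a N)) + u₁ * a N) +
        symD (symShift 2 (linSym (3 * dz (a (N + 1)) + 3 * dz (dz (b (N + 1))) + u₁ * b (N + 1))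
          (3 * dz (b (N + 1))))) = ((N : ℂ) + 1) • linSym (a (N + 1)) (b (N + 1)) := by
      rw [symD_shift_two_linSym, ← h.rec_a, ← h.rec_b]
      have h3 : (3 : ℂ⟦X⟧) = C (3 : ℂ) := (map_ofNat C 3).symm
      have h13 : C (3⁻¹ : ℂ) * (3 : ℂ⟦X⟧) = 1 := by rw [h3, ← map_mul]; norm_num
      ext1 n
      simp only [Pi.add_apply, Pi.smul_apply, linSym]
      split_ifs
      · simp only [smul_eq_C_mul, map_neg, one_div]
        linear_combination (-(X * dz (a (N + 1)) + X * dz (dz (b (N + 1))) + dz (b (N + 1)))) * h13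
      · simp only [smul_eq_C_mul, map_neg, one_div]
        linear_combination (-(X * dz (b (N + 1)))) * h13
      · simp
    have key' := congrArg (symD ^ N) key
    rw [map_add, ← Module.End.mul_apply, ← pow_succ, map_smul] at key'
    rw [ih, e, map_add, map_add, ← key']
    abel

/-- The remainder for the partial sums has degree at most `1 - 2 N`, so it does not reach a given
coefficient once `N` is large. -/
theorem HadamardRec.symL_hadamardSym {u₁ u₀ : ℂ⟦X⟧} {a b : ℕ → ℂ⟦X⟧}
    (h : HadamardRec u₁ u₀ a b) :
    symL u₁ u₀ (hadamardSym a b) = symShift 3 (hadamardSym a b) := by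
  ext1 n
  set N : ℕ := (5 - n).toNat with hN
  have hG : ∀ m, n - 3 ≤ m → hadamardSym a b m = hadamardPartial a b (N + 1) m := fun m hm =>
    hadamardSym_eq_partial a b (by omega)
  have h1 := symT_pow_congr hG 1 n (by norm_num)
  have h3 := symT_pow_congr hG 3 n (by norm_num)
  rw [pow_one] at h1
  have := congrFun (h.symL_partial N) n
  rw [symD_pow_eq_zero (fun _ => linSym_eq_zero _ _) N n (by omega), Pi.sub_apply,
    sub_eq_zero] at this
  simp only [symL, Pi.add_apply, Pi.smul_apply, symShift_apply] at this ⊢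
  rw [h1, h3, hG n (by omega), this, hG _ le_rfl]

theorem HadamardRec.hadamardSym_zero {u₁ u₀ : ℂ⟦X⟧} {a b : ℕ → ℂ⟦X⟧}
    (h : HadamardRec u₁ u₀ a b) : hadamardSym a b 0 = 1 := by
  have := symD_pow_eq_zero (fun _ => linSym_eq_zero (a 1) (b 1)) 1 0 (by norm_num)
  rw [hadamardSym_eq_partial a b (N := 2) (by norm_num), hadamardPartial, Finset.sum_range_succ,
    Finset.sum_range_one, Pi.add_apply, this]
  simp [linSym, h.a_zero]

theorem HadamardRec.hadamardSym_pos {u₁ u₀ : ℂ⟦X⟧} {a b : ℕ → ℂ⟦X⟧}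
    (h : HadamardRec u₁ u₀ a b) {n : ℤ} (hn : 0 < n) : hadamardSym a b n = 0 := by
  rw [hadamardSym_eq_partial a b (N := 1) (by omega), hadamardPartial, Finset.sum_range_one]
  simp [linSym, h.b_zero, hn.ne']

/-! ### Pseudo-differential operators and their symbols -/

/-- The symbol of the operator `∑ p_i ∂ ^ (a - i)`. -/
def toSym (a : ℤ) (p : ℂ⟦X⟧⟦X⟧) : ℤ → ℂ⟦X⟧ := fun n => if n ≤ a then coeff (a - n).toNat p else 0

theorem toSym_add (a : ℤ) (p q : ℂ⟦X⟧⟦X⟧) : toSym a (p + q) = toSym a p + toSym a q := by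
  ext1 n; simp only [toSym, Pi.add_apply]; split_ifs <;> simp

theorem toSym_sum {ι : Type*} (s : Finset ι) (a : ℤ) (p : ι → ℂ⟦X⟧⟦X⟧) :
    toSym a (∑ i ∈ s, p i) = ∑ i ∈ s, toSym a (p i) := by
  ext1 n; simp only [toSym, Finset.sum_apply]; split_ifs <;> simp

theorem toSym_C_mul (a : ℤ) (r : ℂ⟦X⟧) (p : ℂ⟦X⟧⟦X⟧) : toSym a (C r * p) = r • toSym a p := by
  ext1 n; simp only [toSym, Pi.smul_apply, smul_eq_mul]; split_ifs <;> simp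

theorem toSym_X_pow_mul (a : ℤ) (j : ℕ) (p : ℂ⟦X⟧⟦X⟧) :
    toSym a (X ^ j * p) = toSym (a - j) p := by
  ext1 n
  simp only [toSym, coeff_X_pow_mul']
  by_cases h : n ≤ a - j
  · rw [if_pos (by omega), if_pos (by omega), if_pos h]; congr 2; omega
  · rw [if_neg h]
    split_ifs
    · omega
    · rfl
    · rfl

theorem toSym_injective {a : ℤ} {p q : ℂ⟦X⟧⟦X⟧} (h : toSym a p = toSym a q) : p = q := by
  ext1 n
  have := congrFun h (a - n)
  simpa [toSym] using this

theorem toSym_eq_zero (a : ℤ) (p : ℂ⟦X⟧⟦X⟧) {n : ℤ} (h : a < n) : toSym a p n = 0 := by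
  rw [toSym, if_neg (by omega)]

theorem symShift_toSym (a m : ℤ) (p : ℂ⟦X⟧⟦X⟧) : symShift m (toSym a p) = toSym (a + m) p := by
  ext1 n
  simp only [symShift_apply, toSym]
  by_cases h : n ≤ a + m
  · rw [if_pos (by omega), if_pos h]; congr 2; omega
  · rw [if_neg (by omega), if_neg h]

theorem star_C_mul_left (a : ℤ) (r : ℂ⟦X⟧) (p q : ℂ⟦X⟧⟦X⟧) :
    star dz a (C r * p) q = C r * star dz a p q := by
  ext1 n; simp only [coeff_star, coeff_C_mul, mul_sum, mul_assoc]

theorem iterate_dz_one {l : ℕ} (hl : l ≠ 0) : dz^[l] 1 = 0 := by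
  obtain ⟨l, rfl⟩ := Nat.exists_eq_succ_of_ne_zero hl
  rw [Function.iterate_succ_apply, dz_one, iterate_map_zero]

theorem star_one_right (a : ℤ) (p : ℂ⟦X⟧⟦X⟧) : star dz a p 1 = p := by
  ext1 n
  rw [coeff_star, Finset.sum_eq_single (n, 0)]
  · simp
  · rintro ⟨i, m⟩ hx hne
    rw [HasAntidiagonal.mem_antidiagonal] at hx
    refine Finset.sum_eq_zero ?_
    rintro ⟨l, j⟩ hy
    rw [HasAntidiagonal.mem_antidiagonal] at hy
    simp only at hx hy ⊢
    rw [coeff_one]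
    split_ifs with hj
    · rw [iterate_dz_one, mul_zero]
      rintro rfl
      apply hne
      ext <;> simp <;> omega
    · rw [iterate_map_zero, mul_zero]
  · intro h; simp at h

theorem star_one_left (w : ℂ⟦X⟧⟦X⟧) : star dz 0 1 w = w := by
  ext1 n
  rw [coeff_star, Finset.sum_eq_single (0, n), Finset.sum_eq_single (0, n)]
  · simp
  · rintro ⟨l, j⟩ hy hne
    rw [HasAntidiagonal.mem_antidiagonal] at hy
    simp only at hy
    have hl : 0 < l := by
      rw [Nat.pos_iff_ne_zero]; rintro rfl; apply hne; ext <;> simp <;> omega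
    simp [Ring.choose_zero_pos ℤ hl]
  · intro h; simp at h
  · rintro ⟨i, m⟩ hx hne
    rw [HasAntidiagonal.mem_antidiagonal] at hx
    refine Finset.sum_eq_zero fun y _ => ?_
    simp only at hx
    rw [coeff_one, if_neg, zero_mul, zero_mul]
    rintro rfl
    apply hne
    ext <;> simp <;> omega
  · intro h; simp at h

/-- In left multiplication by `∂` only `(1 choose 0)` and `(1 choose 1)` are nonzero, which leaves
`ξ` and `∂_z`. -/
theorem toSym_star_one (a : ℤ) (p : ℂ⟦X⟧⟦X⟧) :
    toSym (a + 1) (star dz 1 1 p) = symT (toSym a p) := by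
  have hz : ∀ l : ℕ, 2 ≤ l → Ring.choose (1 : ℤ) l = 0 := fun l hl => by
    have := Ring.choose_natCast (R := ℤ) 1 l
    rw [Nat.cast_one] at this
    rw [this, Nat.choose_eq_zero_of_lt (by omega), Nat.cast_zero]
  have h0 : coeff 0 (star dz 1 1 p) = coeff 0 p := by
    simp [coeff_star]
  have hs : ∀ n, coeff (n + 1) (star dz 1 1 p) = coeff (n + 1) p + dz (coeff n p) := by
    intro n
    rw [coeff_star, Finset.sum_eq_single (0, n + 1)]
    · simp only [coeff_one, if_true, one_mul, CharP.cast_eq_zero, sub_zero]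
      rw [Finset.Nat.antidiagonal_succ, Finset.sum_cons, Finset.sum_map, Finset.sum_eq_single (0, n)]
      · simp
      · rintro ⟨i, m⟩ hx hne
        rw [HasAntidiagonal.mem_antidiagonal] at hx
        simp only at hx
        simp only [Function.Embedding.prodMap, Function.Embedding.coeFn_mk, Prod.map]
        rw [hz]
        · simp
        · simp only [Nat.succ_eq_add_one]
          by_contra hc
          apply hne
          ext <;> simp <;> omega
      · intro h; simp at h
    · rintro ⟨i, m⟩ hx hne
      rw [HasAntidiagonal.mem_antidiagonal] at hx
      refine Finset.sum_eq_zero fun y _ => ?_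
      simp only at hx
      rw [coeff_one, if_neg, zero_mul, zero_mul]
      rintro rfl
      apply hne
      ext <;> simp <;> omega
    · intro h; simp at h
  ext1 n
  simp only [toSym, symT_apply]
  by_cases h : n ≤ a
  · rw [if_pos (by omega), if_pos h, if_pos (by omega)]
    obtain ⟨j, hj⟩ : ∃ j : ℕ, a - n = j := ⟨(a - n).toNat, by omega⟩
    rw [show (a + 1 - n).toNat = j + 1 by omega, show (a - (n - 1)).toNat = j + 1 by omega,
      show (a - n).toNat = j by omega, hs, add_comm]
  · rw [if_neg h, map_zero, zero_add]
    by_cases h' : n = a + 1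
    · rw [if_pos (by omega), if_pos (by omega), show (a + 1 - n).toNat = 0 by omega,
        show (a - (n - 1)).toNat = 0 by omega, h0]
    · rw [if_neg (by omega), if_neg (by omega)]

theorem toSym_star_one_iterate (k : ℕ) (a : ℤ) (p : ℂ⟦X⟧⟦X⟧) :
    toSym (a + k) ((star dz 1 1)^[k] p) = (symT ^ k) (toSym a p) := by
  induction k with
  | zero => simp
  | succ k ih =>
    rw [Function.iterate_succ_apply', pow_succ', Module.End.mul_apply, ← ih, ← toSym_star_one]
    push_cast; rw [add_assoc]

/-- The coefficient of `∂⁻¹` in `q ∘ r`, for a function `r`, is that of `q` times `r`: nonnegative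
powers of `∂` composed with `r` stay nonnegative, and powers below `-1` stay below `-1`. -/
theorem symRes_toSym_star_C (k : ℕ) (a : ℤ) (p : ℂ⟦X⟧⟦X⟧) (r : ℂ⟦X⟧) :
    symRes k (toSym a (star dz a p (C r))) = constantCoeff r * symRes k (toSym a p) := by
  have h : (star dz 1 1)^[k] (star dz a p (C r)) =
      star dz (a + k) ((star dz 1 1)^[k] p) (C r) := by
    induction k with
    | zero => simp
    | succ k ih =>
      rw [Function.iterate_succ_apply', ih, Function.iterate_succ_apply', ← star_assoc dz dz_mul]
      push_cast; congr 1; ring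
  rw [symRes, symRes, ← toSym_star_one_iterate, ← toSym_star_one_iterate, h]
  generalize (star dz 1 1)^[k] p = q
  generalize a + k = b
  simp only [toSym]
  split_ifs with hb
  · obtain ⟨n, hn⟩ : ∃ n : ℕ, b = n - 1 := ⟨(b + 1).toNat, by omega⟩
    subst hn
    rw [show ((n : ℤ) - 1 - -1).toNat = n by omega, coeff_star, Finset.sum_eq_single (n, 0)]
    · simp [mul_comm]
    · rintro ⟨i, m⟩ hx hne
      rw [HasAntidiagonal.mem_antidiagonal] at hx
      refine Finset.sum_eq_zero ?_
      rintro ⟨l, j⟩ hy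
      rw [HasAntidiagonal.mem_antidiagonal] at hy
      simp only at hx hy ⊢
      rw [coeff_C]
      split_ifs with hj
      · have hm : m ≠ 0 := by
          rintro rfl; apply hne; ext <;> simp <;> omega
        -- A contribution from `l > 0` derivatives carries `(l - 1 choose l) = 0`.
        have e : ((n : ℤ) - 1 - i) = ((l - 1 : ℕ) : ℤ) := by omega
        rw [e, Ring.choose_natCast, Nat.choose_eq_zero_of_lt (by omega)]
        simp
      · rw [iterate_map_zero, mul_zero]
    · intro h; simp at h
  · simp

/-- The sequence of coefficients of `∂ ^ 3 + u₁ ∂ + u₀`. -/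
def seqL (u₁ u₀ : ℂ⟦X⟧) : ℂ⟦X⟧⟦X⟧ := 1 + X ^ 2 * C u₁ + X ^ 3 * C u₀

theorem toSym_star_seqL (u₁ u₀ : ℂ⟦X⟧) (w : ℂ⟦X⟧⟦X⟧) :
    toSym 3 (star dz 3 (seqL u₁ u₀) w) = symL u₁ u₀ (toSym 0 w) := by
  have h3 : star dz 3 1 w = (star dz 1 1)^[3] w := by
    simp only [Function.iterate_succ_apply, Function.iterate_zero, id]
    rw [← star_assoc dz dz_mul, ← star_assoc dz dz_mul, star_one_right, star_one_right]
    norm_num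
  have h1 : star dz 3 (X ^ 2 * C u₁) w = X ^ 2 * (C u₁ * star dz 1 1 w) := by
    rw [star_X_pow_mul_left, ← mul_one (C u₁), star_C_mul_left]; norm_num
  have h0 : star dz 3 (X ^ 3 * C u₀) w = X ^ 3 * (C u₀ * w) := by
    rw [star_X_pow_mul_left, ← mul_one (C u₀), star_C_mul_left, mul_one,
      show (3 : ℤ) - ((3 : ℕ) : ℤ) = 0 by norm_num, star_one_left]
  rw [seqL, star_add_left, star_add_left, h3, h1, h0, toSym_add, toSym_add, toSym_X_pow_mul,
    toSym_X_pow_mul, toSym_C_mul, toSym_C_mul, symL, ← toSym_star_one_iterate,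
    ← toSym_star_one]
  norm_num

end Boussinesq

end

noncomputable section

/-! ### Powers of the cube root and Hadamard coefficients -/

namespace Boussinesq

open PowerSeries Finset

/-- The sequence of coefficients of the `m`-th power of the operator `∑ p_i ∂ ^ (1 - i)`. -/
def seqPow (p : ℂ⟦X⟧⟦X⟧) : ℕ → ℂ⟦X⟧⟦X⟧
  | 0 => 1
  | m + 1 => star dz m (seqPow p m) p

theorem star_seqPow_seqPow (p : ℂ⟦X⟧⟦X⟧) (m n : ℕ) :
    star dz m (seqPow p m) (seqPow p n) = seqPow p (m + n) := by
  induction n with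
  | zero => exact star_one_right _ _
  | succ n ih => rw [seqPow, ← star_assoc dz dz_mul, ih, ← add_assoc, seqPow, Nat.cast_add]

theorem seqPow_one (p : ℂ⟦X⟧⟦X⟧) : seqPow p 1 = p := star_one_left p

theorem coeff_zero_star (a : ℤ) (p q : ℂ⟦X⟧⟦X⟧) :
    coeff 0 (star dz a p q) = coeff 0 p * coeff 0 q := by
  simp [coeff_star]

theorem coeff_star_of_low {a : ℤ} {p d : ℂ⟦X⟧⟦X⟧} {j : ℕ} (hd : ∀ i < j, coeff i d = 0) :
    (∀ i < j, coeff i (star dz a p d) = 0) ∧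
      coeff j (star dz a p d) = coeff 0 p * coeff j d := by
  obtain ⟨e, rfl⟩ := X_pow_dvd_iff.mpr hd
  rw [star_X_pow_mul_right]
  refine ⟨fun i hi => by rw [coeff_X_pow_mul', if_neg (by omega)], ?_⟩
  simp only [coeff_X_pow_mul', le_refl, if_true, Nat.sub_self, coeff_zero_star]

/-- Right multiplication by powers of `∂` leaves coefficient sequences unchanged, so the hypothesis
says `P³ W = W ∂³` and the conclusion `P W = W ∂`. The difference `d` satisfies `d + P d + P² d =
0`; as `P` is monic, its first nonzero coefficient would satisfy `3 d_j = 0`. -/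
theorem star_cubeRoot_eq {p w : ℂ⟦X⟧⟦X⟧} (hp : coeff 0 p = 1)
    (hw : star dz 3 (seqPow p 3) w = w) : star dz 1 p w = w := by
  obtain ⟨d, hd⟩ : ∃ d, star dz 1 p w = w + d := ⟨star dz 1 p w - w, by ring⟩
  have h3 : star dz 1 p (star dz 1 p (star dz 1 p w)) = w := by
    rw [← star_assoc dz dz_mul, ← star_assoc dz dz_mul]
    have h2 := star_seqPow_seqPow p 1 1
    have h3 := star_seqPow_seqPow p 2 1
    rw [seqPow_one, Nat.cast_one] at h2
    rw [seqPow_one, Nat.cast_two] at h3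
    norm_num at h2 h3 ⊢
    rw [h2, h3, hw]
  rw [hd, star_add_right, hd, star_add_right, star_add_right, hd] at h3
  have h4 : d + star dz 1 p d + star dz 1 p (star dz 1 p d) = 0 := by
    linear_combination h3
  have h5 : ∀ j, coeff j d = 0 := by
    intro j
    induction j using Nat.strong_induction_on with
    | _ j ih =>
      obtain ⟨h6, h7⟩ := coeff_star_of_low (a := 1) (p := p) ih
      obtain ⟨-, h8⟩ := coeff_star_of_low (a := 1) (p := p) h6
      have := congrArg (coeff j) h4
      rw [map_add, map_add, h8, h7, hp, map_zero] at this
      have h9 : (3 : ℂ) • coeff j d = 0 := by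
        rw [← this, smul_eq_C_mul, map_ofNat]; ring
      exact (smul_eq_zero.mp h9).resolve_left (by norm_num)
  rw [hd, show d = 0 from PowerSeries.ext fun j => by rw [h5 j, map_zero], add_zero]

theorem star_seqPow_eq {p w : ℂ⟦X⟧⟦X⟧} (h : star dz 1 p w = w) (m : ℕ) :
    star dz m (seqPow p m) w = w := by
  induction m with
  | zero => exact star_one_left w
  | succ m ih =>
    rw [seqPow, Nat.cast_succ, star_assoc dz dz_mul, h, ih]

/-- A truncated right inverse of `W`, written `∑ ∂ ^ (-j) v_j` with the functions on the right. As
`W` is monic, each `v_j` is the leading coefficient of the current remainder. -/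
theorem exists_decomposition {w : ℂ⟦X⟧⟦X⟧} (hw : coeff 0 w = 1) (n : ℕ) :
    ∃ (v : ℕ → ℂ⟦X⟧) (e : ℂ⟦X⟧⟦X⟧), v 0 = 1 ∧
      1 = ∑ j ∈ range (n + 1), X ^ j * star dz (-j) w (C (v j)) + X ^ (n + 1) * e := by
  induction n with
  | zero =>
    have : X ∣ 1 - w := by
      rw [X_dvd_iff, map_sub, ← coeff_zero_eq_constantCoeff_apply w, hw]; simp
    obtain ⟨e, he⟩ := this
    refine ⟨fun _ => 1, e, rfl, ?_⟩
    simp only [zero_add, Finset.sum_range_one, pow_zero, one_mul, map_one, star_one_right, pow_one]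
    rw [← he]; ring
  | succ n ih =>
    obtain ⟨v, e, hv, h⟩ := ih
    have : X ∣ e - star dz (-(n + 1 : ℕ)) w (C (coeff 0 e)) := by
      rw [X_dvd_iff, ← coeff_zero_eq_constantCoeff_apply, map_sub, coeff_zero_star, hw]; simp
    obtain ⟨e', he'⟩ := this
    refine ⟨Function.update v (n + 1) (coeff 0 e), e', ?_, ?_⟩
    · rw [Function.update_of_ne (by omega), hv]
    · rw [Finset.sum_range_succ, Function.update_self]
      have : ∑ j ∈ range (n + 1), X ^ j * star dz (-j) w
          (C (Function.update v (n + 1) (coeff 0 e) j)) =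
          ∑ j ∈ range (n + 1), X ^ j * star dz (-j) w (C (v j)) := by
        refine Finset.sum_congr rfl fun j hj => ?_
        rw [mem_range] at hj
        rw [Function.update_of_ne (by omega)]
      rw [this]
      refine h.trans ?_
      linear_combination X ^ (n + 1) * he'

theorem symT_pow_top {f : ℤ → ℂ⟦X⟧} {N : ℤ} (hf : ∀ n, N < n → f n = 0) (k : ℕ) :
    (symT ^ k) f (N + k) = f N := by
  induction k with
  | zero => simp
  | succ k ih =>
    rw [pow_succ', Module.End.mul_apply, symT_apply, symT_pow_eq_zero hf k _ (by push_cast; omega),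
      ← ih]
    push_cast
    rw [map_zero, zero_add]; ring_nf

theorem symRes_eq_zero_of_low {f : ℤ → ℂ⟦X⟧} {N : ℤ} (hf : ∀ n, N < n → f n = 0) {k : ℕ}
    (h : N + k < -1) : symRes k f = 0 := by
  rw [symRes, symT_pow_eq_zero hf k _ h, map_zero]

theorem symRes_toSym_one (k : ℕ) : symRes k (toSym 0 1) = 0 := by
  have : ∀ i : ℕ, (star dz 1 1)^[i] (1 : ℂ⟦X⟧⟦X⟧) = 1 := fun i => by
    induction i with
    | zero => rfl
    | succ i ih => rw [Function.iterate_succ_apply', ih, star_one_right]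
  rw [symRes, ← toSym_star_one_iterate, this, toSym]
  split_ifs
  · rw [coeff_one, if_neg (by omega), map_zero]
  · exact map_zero _

/-- Expanding `P ^ m = P ^ m ∘ 1 = ∑ W ∂ ^ (m - j) v_j`, each `v_j` enters residues only through its
value at `z = 0`. For `m = 0`, the vanishing residues of both the identity and `W` force these
values to be zero for `j ≥ 1`, and only `v_0 = 1` remains. -/
theorem symRes_toSym_seqPow {p w : ℂ⟦X⟧⟦X⟧} (hw0 : coeff 0 w = 1) (h : star dz 1 p w = w)
    (hres : ∀ k, symRes k (toSym 0 w) = 0) (m k : ℕ) :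
    symRes k (toSym m (seqPow p m)) = symRes k (toSym m w) := by
  obtain ⟨v, e, hv0, hdec⟩ := exists_decomposition hw0 (m + k + 1)
  -- With this length the remainder, after `k` applications of `symT`, has order below `-1` and no
  -- residue.
  set n := m + k + 1 with hn
  have key : ∀ m' k' : ℕ, m' + k' < n → symRes k' (toSym m' (seqPow p m')) =
      ∑ j ∈ range (n + 1), constantCoeff (v j) * symRes k' (toSym (m' - j) w) := by
    intro m' k' hmk
    have h1 : seqPow p m' = ∑ j ∈ range (n + 1), X ^ j * star dz (m' - j) w (C (v j)) +
        X ^ (n + 1) * star dz m' (seqPow p m') e := by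
      conv_lhs => rw [← star_one_right m' (seqPow p m'), hdec]
      rw [star_add_right, star_sum_right, star_X_pow_mul_right]
      congr 1
      refine Finset.sum_congr rfl fun j _ => ?_
      rw [star_X_pow_mul_right, ← star_assoc dz dz_mul, star_seqPow_eq h, sub_eq_add_neg]
    rw [h1, toSym_add, symRes_add, toSym_sum, symRes_sum, toSym_X_pow_mul,
      symRes_eq_zero_of_low (fun _ => toSym_eq_zero _ _) (by push_cast; omega), add_zero]
    refine Finset.sum_congr rfl fun j _ => ?_
    rw [toSym_X_pow_mul, symRes_toSym_star_C]
  have hv : ∀ j, 1 ≤ j → j ≤ n → constantCoeff (v j) = 0 := by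
    intro j
    induction j using Nat.strong_induction_on with
    | _ j ih =>
      intro hj1 hjn
      -- The system is triangular: with `j - 1` derivatives, `W ∂ ^ (-j)` has residue exactly 1, and
      -- later terms have order too low to contribute.
      have h0 := key 0 (j - 1) (by omega)
      have h1 : symRes (j - 1) (toSym ((0 : ℕ) : ℤ) (seqPow p 0)) = 0 := symRes_toSym_one _
      rw [h1, Finset.sum_eq_single j] at h0
      · rw [symRes] at h0
        have h2 := symT_pow_top (fun n => toSym_eq_zero (-(j : ℤ)) w (n := n)) (j - 1)
        rw [show -(j : ℤ) + ((j - 1 : ℕ) : ℤ) = -1 by omega] at h2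
        rw [show ((0 : ℕ) : ℤ) - j = -j by simp, h2, toSym, if_pos le_rfl] at h0
        simpa [hw0] using h0.symm
      · intro i hi hne
        rw [mem_range] at hi
        rcases Nat.eq_zero_or_pos i with rfl | hi0
        · simp [hres]
        rcases lt_or_gt_of_ne hne with hlt | hgt
        · rw [ih i hlt hi0 (by omega), zero_mul]
        · rw [symRes_eq_zero_of_low (fun _ => toSym_eq_zero _ _) (by omega), mul_zero]
      · intro hj; simp only [mem_range] at hj; omega
  rw [key m k (by omega), Finset.sum_eq_single 0]
  · simp [hv0]
  · intro j hj hne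
    rw [mem_range] at hj
    rw [hv j (by omega) (by omega), zero_mul]
  · intro hj; simp at hj

theorem symRes_zero_toSym (m : ℕ) (q : ℂ⟦X⟧⟦X⟧) :
    symRes 0 (toSym m q) = constantCoeff (coeff (m + 1) q) := by
  rw [symRes, pow_zero, Module.End.one_apply, toSym, if_pos (by omega)]
  congr 2

theorem symRes_one_toSym (m : ℕ) (q : ℂ⟦X⟧⟦X⟧) :
    symRes 1 (toSym m q) = constantCoeff (dz (coeff (m + 1) q) + coeff (m + 2) q) := by
  rw [symRes, pow_one, symT_apply]
  simp only [toSym]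
  rw [if_pos (by omega), if_pos (by omega),
    show ((m : ℤ) - -1).toNat = m + 1 by omega, show ((m : ℤ) - (-1 - 1)).toNat = m + 2 by omega]

theorem symRes_zero_linSym (m : ℤ) (a b : ℂ⟦X⟧) :
    symRes 0 (symShift m (linSym a b)) = constantCoeff (linSym a b (-1 - m)) := rfl

theorem symRes_one_linSym (m : ℤ) (a b : ℂ⟦X⟧) :
    symRes 1 (symShift m (linSym a b)) =
      constantCoeff (dz (linSym a b (-1 - m))) + constantCoeff (linSym a b (-2 - m)) := by
  rw [symRes, pow_one, symT_apply, map_add, symShift_apply, symShift_apply]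
  norm_num

/-- The operator `W` with symbol `hadamardSym a b` satisfies `L W = W ∂³`, and it is normalized
because for `m = 0` every term with `l ≥ 1` carries the factor `i = 0` of the product. -/
theorem HadamardRec.symRes_seqPow {u₁ u₀ : ℂ⟦X⟧} {a b : ℕ → ℂ⟦X⟧} (h : HadamardRec u₁ u₀ a b)
    {p : ℂ⟦X⟧⟦X⟧} (hp : coeff 0 p = 1) (hcube : seqPow p 3 = seqL u₁ u₀) (m k N : ℕ)
    (hN : m + k + 3 ≤ N) :
    symRes k (toSym m (seqPow p m)) = ∑ l ∈ range N,
      (∏ i ∈ range l, ((m : ℂ) / 3 - i)) *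
        symRes k (symShift (m - 3 * l) (linSym (a l) (b l))) := by
  set w : ℂ⟦X⟧⟦X⟧ := PowerSeries.mk fun j => hadamardSym a b (-j) with hw
  have hG : toSym 0 w = hadamardSym a b := by
    ext1 n
    rw [toSym]
    split_ifs with hn
    · rw [hw, coeff_mk]; congr 1; omega
    · rw [h.hadamardSym_pos (by omega)]
  have hGm : ∀ m : ℤ, toSym m w = symShift m (hadamardSym a b) := fun m => by
    rw [← hG, symShift_toSym, zero_add]
  have h0 : coeff 0 w = 1 := by rw [hw, coeff_mk, Nat.cast_zero, neg_zero, h.hadamardSym_zero]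
  have hLw : star dz 3 (seqPow p 3) w = w := by
    apply toSym_injective (a := 3)
    rw [hcube, toSym_star_seqL, hG, h.symL_hadamardSym, hGm]
  rw [symRes_toSym_seqPow h0 (star_cubeRoot_eq hp hLw), hGm, symRes_shift_hadamardSym a b k m
    (N := N) (by exact_mod_cast hN)]
  · simp only [Int.cast_natCast]
  · intro k
    rw [hGm, symRes_shift_hadamardSym a b k 0 (N := k + 3) (by push_cast; omega)]
    refine Finset.sum_eq_zero fun l _ => ?_
    rcases Nat.eq_zero_or_pos l with rfl | hl
    · have : symShift (0 - 3 * ((0 : ℕ) : ℤ)) (linSym (a 0) (b 0)) = toSym 0 1 := by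
        ext1 n
        rw [h.a_zero, h.b_zero, symShift_apply, toSym, coeff_one, linSym]
        split_ifs <;> first | rfl | omega
      rw [this, symRes_toSym_one, mul_zero]
    · rw [Finset.prod_eq_zero (mem_range.mpr hl), zero_mul]
      simp

theorem prod_range_sub_eq_poch (c : ℂ) (k : ℕ) :
    ∏ i ∈ range k, (c + k - 1 - i) = poch c k := by
  have : poch c k = ∏ i ∈ range k, (c + i) := by
    induction k with
    | zero => simp [poch]
    | succ k ih => rw [Finset.prod_range_succ, ← ih, poch, ascPochhammer_succ_eval, poch]
  rw [this, ← Finset.prod_range_reflect]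
  refine Finset.prod_congr rfl fun i hi => ?_
  rw [mem_range] at hi
  rw [Nat.sub_sub, Nat.cast_sub (by omega)]
  push_cast; ring

section

variable {u₁ u₀ : ℂ⟦X⟧} {a b : ℕ → ℂ⟦X⟧}

/-- Only `l = k` contributes: there the symbol is `ξ⁻² (a_k + b_k ξ)`, whose residue is `b_k` and
whose residue after one `∂_z + ξ` is `a_k + b_k'`. -/
theorem HadamardRec.residues_one_mod_three (h : HadamardRec u₁ u₀ a b)
    {p : ℂ⟦X⟧⟦X⟧} (hp : coeff 0 p = 1) (hcube : seqPow p 3 = seqL u₁ u₀) {m k : ℕ}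
    (hm : m + 2 = 3 * k) :
    constantCoeff (coeff (m + 1) (seqPow p m)) = poch (1 / 3) k * constantCoeff (b k) ∧
    constantCoeff (dz (coeff (m + 1) (seqPow p m)) + coeff (m + 2) (seqPow p m)) =
      poch (1 / 3) k * (constantCoeff (a k) + constantCoeff (dz (b k))) := by
  have hprod : ∏ i ∈ range k, ((m : ℂ) / 3 - i) = poch (1 / 3) k := by
    rw [← prod_range_sub_eq_poch]
    have : (m : ℂ) = 3 * k - 2 := by rw [eq_sub_iff_add_eq]; exact_mod_cast hm
    rw [this]
    exact Finset.prod_congr rfl fun i _ => by ring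
  rw [← symRes_zero_toSym, ← symRes_one_toSym, h.symRes_seqPow hp hcube m 0 (m + 4) (by omega),
    h.symRes_seqPow hp hcube m 1 (m + 4) (by omega)]
  constructor
  · rw [Finset.sum_eq_single k, hprod, symRes_zero_linSym]
    · simp [linSym, show -1 - ((m : ℤ) - 3 * k) = 1 by omega]
    · intro l _ hl
      rw [symRes_zero_linSym, linSym, if_neg (by omega), if_neg (by omega), map_zero, mul_zero]
    · intro hk; simp only [mem_range] at hk; omega
  · rw [Finset.sum_eq_single k, hprod, symRes_one_linSym]
    · simp [linSym, show -1 - ((m : ℤ) - 3 * k) = 1 by omega,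
        show -2 - ((m : ℤ) - 3 * k) = 0 by omega, add_comm]
    · intro l _ hl
      rw [symRes_one_linSym, linSym, if_neg (by omega), if_neg (by omega), linSym,
        if_neg (by omega), if_neg (by omega)]
      simp
    · intro hk; simp only [mem_range] at hk; omega

/-- Only `l = k` contributes, now with the symbol `ξ⁻¹ (a_k + b_k ξ)`. -/
theorem HadamardRec.residues_two_mod_three (h : HadamardRec u₁ u₀ a b)
    {p : ℂ⟦X⟧⟦X⟧} (hp : coeff 0 p = 1) (hcube : seqPow p 3 = seqL u₁ u₀) {m k : ℕ}
    (hm : m + 1 = 3 * k) :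
    constantCoeff (coeff (m + 1) (seqPow p m)) = poch (2 / 3) k * constantCoeff (a k) ∧
    constantCoeff (dz (coeff (m + 1) (seqPow p m)) + coeff (m + 2) (seqPow p m)) =
      poch (2 / 3) k * constantCoeff (dz (a k)) := by
  have hprod : ∏ i ∈ range k, ((m : ℂ) / 3 - i) = poch (2 / 3) k := by
    rw [← prod_range_sub_eq_poch]
    have : (m : ℂ) = 3 * k - 1 := by rw [eq_sub_iff_add_eq]; exact_mod_cast hm
    rw [this]
    exact Finset.prod_congr rfl fun i _ => by ring
  rw [← symRes_zero_toSym, ← symRes_one_toSym, h.symRes_seqPow hp hcube m 0 (m + 4) (by omega),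
    h.symRes_seqPow hp hcube m 1 (m + 4) (by omega)]
  constructor
  · rw [Finset.sum_eq_single k, hprod, symRes_zero_linSym]
    · simp [linSym, show -1 - ((m : ℤ) - 3 * k) = 0 by omega]
    · intro l _ hl
      rw [symRes_zero_linSym, linSym, if_neg (by omega), if_neg (by omega), map_zero, mul_zero]
    · intro hk; simp only [mem_range] at hk; omega
  · rw [Finset.sum_eq_single k, hprod, symRes_one_linSym]
    · simp [linSym, show -1 - ((m : ℤ) - 3 * k) = 0 by omega,
        show -2 - ((m : ℤ) - 3 * k) = -1 by omega]
    · intro l _ hl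
      rw [symRes_one_linSym, linSym, if_neg (by omega), if_neg (by omega), linSym,
        if_neg (by omega), if_neg (by omega)]
      simp
    · intro hk; simp only [mem_range] at hk; omega

/-- For `l ≤ k` no negative power of `ξ` occurs, and for `l > k` the product contains `m / 3 - k =
0`. -/
theorem HadamardRec.residues_zero_mod_three (h : HadamardRec u₁ u₀ a b)
    {p : ℂ⟦X⟧⟦X⟧} (hp : coeff 0 p = 1) (hcube : seqPow p 3 = seqL u₁ u₀) {m k : ℕ}
    (hm : m = 3 * k) :
    constantCoeff (coeff (m + 1) (seqPow p m)) = 0 ∧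
    constantCoeff (dz (coeff (m + 1) (seqPow p m)) + coeff (m + 2) (seqPow p m)) = 0 := by
  rw [← symRes_zero_toSym, ← symRes_one_toSym, h.symRes_seqPow hp hcube m 0 (m + 4) (by omega),
    h.symRes_seqPow hp hcube m 1 (m + 4) (by omega)]
  constructor
  · refine Finset.sum_eq_zero fun l _ => ?_
    rw [symRes_zero_linSym, linSym, if_neg (by omega), if_neg (by omega), map_zero, mul_zero]
  · refine Finset.sum_eq_zero fun l _ => ?_
    by_cases hl : l ≤ k
    · rw [symRes_one_linSym, linSym, if_neg (by omega), if_neg (by omega), linSym,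
        if_neg (by omega), if_neg (by omega)]
      simp
    · rw [Finset.prod_eq_zero (i := k) (by rw [mem_range]; omega), zero_mul]
      rw [hm]; push_cast; ring

end

end Boussinesq

end

noncomputable section

/-! ### Taylor series of smooth functions and of pseudo-differential operators -/

namespace Boussinesq

open PowerSeries Finset Filter Topology

/-- The Taylor series of `f` at `y`. -/
def jet (y : ℝ) (f : ℝ → ℂ) : ℂ⟦X⟧ := PowerSeries.mk fun n => iteratedDeriv n f y / n.factorial

theorem coeff_jet (y : ℝ) (f : ℝ → ℂ) (n : ℕ) :
    coeff n (jet y f) = iteratedDeriv n f y / n.factorial := coeff_mk _ _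

theorem constantCoeff_jet (y : ℝ) (f : ℝ → ℂ) : constantCoeff (jet y f) = f y := by
  rw [← coeff_zero_eq_constantCoeff_apply, coeff_jet]; simp

theorem jet_congr {y : ℝ} {f g : ℝ → ℂ} (h : f =ᶠ[𝓝 y] g) : jet y f = jet y g := by
  ext n; rw [coeff_jet, coeff_jet, h.iteratedDeriv_eq]

theorem jet_deriv (y : ℝ) (f : ℝ → ℂ) : jet y (deriv f) = dz (jet y f) := by
  ext n
  rw [coeff_dz, coeff_jet, coeff_jet, ← iteratedDeriv_succ', Nat.factorial_succ]
  have : (n.factorial : ℂ) ≠ 0 := by exact_mod_cast n.factorial_ne_zero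
  have h' : (n : ℂ) + 1 ≠ 0 := by exact_mod_cast n.succ_ne_zero
  push_cast
  field_simp

theorem jet_iteratedDeriv (y : ℝ) (f : ℝ → ℂ) (l : ℕ) :
    jet y (iteratedDeriv l f) = dz^[l] (jet y f) := by
  induction l with
  | zero => simp
  | succ l ih => rw [iteratedDeriv_succ, jet_deriv, ih, Function.iterate_succ_apply']

theorem jet_const (y : ℝ) (c : ℂ) : jet y (fun _ => c) = C c := by
  ext n
  rw [coeff_jet, iteratedDeriv_const, coeff_C]
  split_ifs with h
  · subst h; simp
  · simp

theorem jet_ofReal_sub (y : ℝ) : jet y (fun x => (x : ℂ) - y) = X := by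
  have h : deriv (fun x : ℝ => (x : ℂ) - y) = fun _ => 1 := by
    ext x
    exact ((Complex.ofRealCLM.hasDerivAt (x := x)).sub_const (y : ℂ)).deriv
  ext n
  rw [coeff_jet]
  cases n with
  | zero => simp
  | succ n =>
    rw [iteratedDeriv_succ', h, iteratedDeriv_const, coeff_X]
    split_ifs with h1 h2
    · subst h1; simp
    · omega
    · omega
    · simp

section

variable {y : ℝ} {f g : ℝ → ℂ}

theorem jet_add (hf : ContDiffAt ℝ (⊤ : ℕ∞) f y) (hg : ContDiffAt ℝ (⊤ : ℕ∞) g y) :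
    jet y (fun x => f x + g x) = jet y f + jet y g := by
  ext n
  rw [map_add, coeff_jet, coeff_jet, coeff_jet, ← add_div, iteratedDeriv_fun_add
    (hf.of_le (by exact_mod_cast le_top)) (hg.of_le (by exact_mod_cast le_top))]

theorem jet_mul (hf : ContDiffAt ℝ (⊤ : ℕ∞) f y) (hg : ContDiffAt ℝ (⊤ : ℕ∞) g y) :
    jet y (fun x => f x * g x) = jet y f * jet y g := by
  ext n
  rw [coeff_mul, coeff_jet, iteratedDeriv_fun_mul (hf.of_le (by exact_mod_cast le_top))
    (hg.of_le (by exact_mod_cast le_top)), Finset.Nat.sum_antidiagonal_eq_sum_range_succ_mk,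
    Finset.sum_div]
  refine Finset.sum_congr rfl fun i hi => ?_
  rw [mem_range] at hi
  rw [coeff_jet, coeff_jet, Nat.cast_choose ℂ (by omega : i ≤ n)]
  have h1 : (n.factorial : ℂ) ≠ 0 := by exact_mod_cast n.factorial_ne_zero
  field_simp

theorem jet_sum {ι : Type*} {s : Finset ι} {F : ι → ℝ → ℂ}
    (hF : ∀ i ∈ s, ContDiffAt ℝ (⊤ : ℕ∞) (F i) y) :
    jet y (fun x => ∑ i ∈ s, F i x) = ∑ i ∈ s, jet y (F i) := by
  ext n
  rw [map_sum, coeff_jet, iteratedDeriv_fun_sum fun i hi =>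
    (hF i hi).of_le (by exact_mod_cast le_top), Finset.sum_div]
  simp only [coeff_jet]

theorem contDiffAt_deriv (hf : ContDiffAt ℝ (⊤ : ℕ∞) f y) :
    ContDiffAt ℝ (⊤ : ℕ∞) (deriv f) y := by
  have h := (hf.fderiv_right (m := (⊤ : ℕ∞)) le_rfl).clm_apply
    (contDiffAt_const (c := (1 : ℝ)))
  exact h

theorem contDiffAt_iteratedDeriv (hf : ContDiffAt ℝ (⊤ : ℕ∞) f y) (l : ℕ) :
    ContDiffAt ℝ (⊤ : ℕ∞) (iteratedDeriv l f) y := by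
  induction l with
  | zero => simpa using hf
  | succ l ih => rw [iteratedDeriv_succ]; exact contDiffAt_deriv ih

end

namespace PsiDO

/-- All coefficients are smooth at `y`. -/
def SmoothAt (P : PsiDO) (y : ℝ) : Prop := ∀ i, ContDiffAt ℝ (⊤ : ℕ∞) (P.coeff i) y

/-- The Taylor series at `y` of the coefficients. -/
def jetSeq (y : ℝ) (P : PsiDO) : ℂ⟦X⟧⟦X⟧ := PowerSeries.mk fun i => jet y (P.coeff i)

theorem coeff_jetSeq (y : ℝ) (P : PsiDO) (i : ℕ) : PowerSeries.coeff i (jetSeq y P) = jet y (P.coeff i) :=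
  coeff_mk _ _

theorem SmoothAt.mul {P Q : PsiDO} {y : ℝ} (hP : P.SmoothAt y) (hQ : Q.SmoothAt y) :
    (mul P Q).SmoothAt y := by
  intro n
  simp only [PsiDO.mul]
  exact ContDiffAt.sum fun _ _ => ContDiffAt.sum fun _ _ =>
    ((hP _).mul contDiffAt_const).mul (contDiffAt_iteratedDeriv (hQ _) _)

theorem jetSeq_mul {P Q : PsiDO} {y : ℝ} (hP : P.SmoothAt y) (hQ : Q.SmoothAt y) :
    jetSeq y (mul P Q) = star dz P.order (jetSeq y P) (jetSeq y Q) := by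
  ext1 n
  have h1 : ∀ i l : ℕ, ContDiffAt ℝ (⊤ : ℕ∞) (fun x => P.coeff i x *
      ((Ring.choose (P.order - (i : ℤ)) l : ℤ) : ℂ)) y := fun i l =>
    (hP _).mul contDiffAt_const
  have h2 : ∀ i l j : ℕ, ContDiffAt ℝ (⊤ : ℕ∞) (fun x => P.coeff i x *
      ((Ring.choose (P.order - (i : ℤ)) l : ℤ) : ℂ) * iteratedDeriv l (Q.coeff j) x) y :=
    fun i l j => (h1 i l).mul (contDiffAt_iteratedDeriv (hQ _) _)
  rw [coeff_jetSeq, coeff_star, PsiDO.mul]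
  simp only
  rw [jet_sum fun _ _ => ContDiffAt.sum fun _ _ => h2 _ _ _]
  refine Finset.sum_congr rfl fun x _ => ?_
  rw [jet_sum fun _ _ => h2 _ _ _]
  refine Finset.sum_congr rfl fun z _ => ?_
  rw [jet_mul (h1 _ _) (contDiffAt_iteratedDeriv (hQ _) _), jet_mul (hP _) contDiffAt_const,
    jet_const, jet_iteratedDeriv, coeff_jetSeq, coeff_jetSeq, map_intCast]

theorem smoothAt_one (y : ℝ) : one.SmoothAt y := fun _ => contDiffAt_const

theorem jetSeq_one (y : ℝ) : jetSeq y one = 1 := by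
  ext1 n
  rw [coeff_jetSeq, one, coeff_one]
  simp only [jet_const]
  split_ifs <;> simp

theorem SmoothAt.pow {P : PsiDO} {y : ℝ} (hP : P.SmoothAt y) (m : ℕ) : (P.pow m).SmoothAt y := by
  induction m with
  | zero => exact smoothAt_one y
  | succ m ih => exact ih.mul hP

theorem order_pow {P : PsiDO} (h : P.order = 1) (m : ℕ) : (P.pow m).order = m := by
  induction m with
  | zero => rfl
  | succ m ih =>
    change (P.pow m).order + P.order = _
    rw [ih, h]; push_cast; ring

theorem jetSeq_pow {P : PsiDO} {y : ℝ} (h : P.order = 1) (hP : P.SmoothAt y) (m : ℕ) :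
    jetSeq y (P.pow m) = seqPow (jetSeq y P) m := by
  induction m with
  | zero => exact jetSeq_one y
  | succ m ih => rw [PsiDO.pow, jetSeq_mul (hP.pow m) hP, ih, order_pow h, seqPow]

end PsiDO

open PsiDO

theorem smoothAt_opL {u₁ u₀ : ℝ → ℂ} {y : ℝ} (h₁ : ContDiffAt ℝ (⊤ : ℕ∞) u₁ y)
    (h₀ : ContDiffAt ℝ (⊤ : ℕ∞) u₀ y) : (opL u₁ u₀).SmoothAt y := by
  intro i
  simp only [opL]
  split_ifs
  · exact contDiffAt_const
  · exact h₁
  · exact h₀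
  · exact contDiffAt_const

theorem coeff_seqL (v₁ v₀ : ℂ⟦X⟧) (i : ℕ) : PowerSeries.coeff i (seqL v₁ v₀) =
    if i = 0 then 1 else if i = 2 then v₁ else if i = 3 then v₀ else 0 := by
  rw [seqL, map_add, map_add, coeff_one, coeff_X_pow_mul', coeff_X_pow_mul', coeff_C, coeff_C]
  rcases i with _ | _ | _ | _ | i <;> simp

theorem jetSeq_opL (u₁ u₀ : ℝ → ℂ) (y : ℝ) :
    jetSeq y (opL u₁ u₀) = seqL (jet y u₁) (jet y u₀) := by
  ext1 i
  rw [coeff_jetSeq, coeff_seqL, opL]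
  simp only
  split_ifs
  · rw [jet_const, map_one]
  · rfl
  · rfl
  · rw [jet_const, map_zero]

namespace PsiDO

theorem IsCubeRoot.smoothAt {U : Set ℝ} {P L : PsiDO} (h : IsCubeRoot U P L) (hU : IsOpen U)
    {y : ℝ} (hy : y ∈ U) : P.SmoothAt y := fun i => (h.smooth i).contDiffAt (hU.mem_nhds hy)

theorem IsCubeRoot.coeff_zero_jetSeq {U : Set ℝ} {P L : PsiDO} (h : IsCubeRoot U P L)
    (hU : IsOpen U) {y : ℝ} (hy : y ∈ U) : PowerSeries.coeff 0 (jetSeq y P) = 1 := by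
  rw [coeff_jetSeq, jet_congr (g := fun _ => 1), jet_const, map_one]
  filter_upwards [hU.mem_nhds hy] with x hx using h.monic x hx

theorem IsCubeRoot.seqPow_three {U : Set ℝ} {P : PsiDO} {u₁ u₀ : ℝ → ℂ}
    (h : IsCubeRoot U P (opL u₁ u₀)) (hU : IsOpen U) {y : ℝ} (hy : y ∈ U) :
    seqPow (jetSeq y P) 3 = seqL (jet y u₁) (jet y u₀) := by
  rw [← jetSeq_pow h.order_eq (h.smoothAt hU hy), ← jetSeq_opL]
  ext1 i
  rw [coeff_jetSeq, coeff_jetSeq]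
  refine jet_congr ?_
  filter_upwards [hU.mem_nhds hy] with x hx
  have := h.cube (3 - i) x hx
  rw [coeffAt, coeffAt, order_pow h.order_eq, if_pos (by norm_num), if_pos (by simp [opL])] at this
  simpa [opL] using this

end PsiDO

/-! ### The commutator of the positive part with `L` -/

/-- Here `r` stands for an operator of order `-1`, so the three coefficients belong to `∂²`, `∂` and
`1`. -/
theorem coeff_comm_of_low (v₁ v₀ : ℂ⟦X⟧) (r : ℂ⟦X⟧⟦X⟧) :
    PowerSeries.coeff 0 (star dz 3 (seqL v₁ v₀) r - star dz (-1) r (seqL v₁ v₀)) = 0 ∧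
    PowerSeries.coeff 1 (star dz 3 (seqL v₁ v₀) r - star dz (-1) r (seqL v₁ v₀)) =
      3 * dz (coeff 0 r) ∧
    PowerSeries.coeff 2 (star dz 3 (seqL v₁ v₀) r - star dz (-1) r (seqL v₁ v₀)) =
      3 * dz (dz (coeff 0 r) + coeff 1 r) := by
  have c : Ring.choose (3 : ℤ) 2 = 3 := by
    have := Ring.choose_natCast (R := ℤ) 3 2
    norm_num at this; simpa using this
  refine ⟨?_, ?_, ?_⟩
  · rw [map_sub, coeff_zero_star, coeff_zero_star, mul_comm, sub_self]
  · simp [coeff_star, coeff_seqL, Finset.Nat.antidiagonal_succ]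
  · simp [coeff_star, coeff_seqL, Finset.Nat.antidiagonal_succ, c]
    ring

/-- Writing `P ^ m = q + X ^ (m + 1) r` with `r` of order `-1`, commutation of `P ^ m` with `L`
turns `[q, L]` into `[L, r]`, which controls the nonnegative powers of `∂`. Negative powers are
absent since `q` and `L` are differential operators. -/
theorem coeff_comm_posPart {p : ℂ⟦X⟧⟦X⟧} {v₁ v₀ : ℂ⟦X⟧} (hcube : seqPow p 3 = seqL v₁ v₀) (m j : ℕ)
    {q : ℂ⟦X⟧⟦X⟧} (hq : ∀ i, PowerSeries.coeff i q = if i ≤ m then coeff i (seqPow p m) else 0) :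
    PowerSeries.coeff j (star dz m q (seqL v₁ v₀) - star dz 3 (seqL v₁ v₀) q) =
      if j = m + 2 then 3 * dz (coeff (m + 1) (seqPow p m)) else
      if j = m + 3 then 3 * dz (dz (coeff (m + 1) (seqPow p m)) + coeff (m + 2) (seqPow p m))
      else 0 := by
  obtain ⟨r, hr⟩ : X ^ (m + 1) ∣ seqPow p m - q := by
    refine X_pow_dvd_iff.mpr fun i hi => ?_
    rw [map_sub, hq, if_pos (by omega), sub_self]
  have hrc : ∀ i, coeff i r = coeff (m + 1 + i) (seqPow p m) := by
    intro i
    have := congrArg (PowerSeries.coeff (m + 1 + i)) hr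
    rw [map_sub, hq, if_neg (by omega), sub_zero, coeff_X_pow_mul', if_pos (by omega),
      Nat.add_sub_cancel_left] at this
    exact this.symm
  have hcomm : star dz m (seqPow p m) (seqL v₁ v₀) = star dz 3 (seqL v₁ v₀) (seqPow p m) := by
    have h1 := star_seqPow_seqPow p m 3
    have h2 := star_seqPow_seqPow p 3 m
    rw [hcube] at h1 h2
    rw [h1, add_comm, ← h2]
    norm_num
  have key : star dz m q (seqL v₁ v₀) - star dz 3 (seqL v₁ v₀) q =
      X ^ (m + 1) * (star dz 3 (seqL v₁ v₀) r - star dz (-1) r (seqL v₁ v₀)) := by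
    rw [sub_eq_iff_eq_add] at hr
    rw [hr, star_add_left, star_add_right, star_X_pow_mul_left, star_X_pow_mul_right,
      show (m : ℤ) - ((m + 1 : ℕ) : ℤ) = -1 by push_cast; ring] at hcomm
    linear_combination hcomm
  obtain ⟨h0, h1, h2⟩ := coeff_comm_of_low v₁ v₀ r
  by_cases hj : j ≤ m + 3
  · rw [key, coeff_X_pow_mul']
    by_cases h : m + 1 ≤ j
    · rw [if_pos h]
      obtain ⟨i, rfl⟩ : ∃ i, j = m + 1 + i := ⟨j - (m + 1), by omega⟩
      rw [Nat.add_sub_cancel_left]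
      have hi : i = 0 ∨ i = 1 ∨ i = 2 := by omega
      rcases hi with rfl | rfl | rfl
      · rw [h0, if_neg (by omega), if_neg (by omega)]
      · rw [h1, if_pos (by omega), hrc]
      · rw [h2, if_neg (by omega), if_pos (by omega), hrc, hrc]
    · rw [if_neg h, if_neg (by omega), if_neg (by omega)]
  -- Beyond `j = m + 3` the power of `∂` is negative; each product term dies by a vanishing binomial
  -- coefficient or a missing coefficient.
  · have hch : ∀ (a i l : ℕ), i ≤ a → a < i + l → Ring.choose ((a : ℤ) - i) l = 0 := by
      intro a i l hi hl
      rw [← Nat.cast_sub hi, Ring.choose_natCast, Nat.choose_eq_zero_of_lt (by omega),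
        Nat.cast_zero]
    rw [if_neg (by omega), if_neg (by omega), map_sub, coeff_star, coeff_star,
      Finset.sum_eq_zero, Finset.sum_eq_zero, sub_zero]
    · rintro ⟨i, n⟩ hx
      refine Finset.sum_eq_zero ?_
      rintro ⟨l, n'⟩ hy
      rw [HasAntidiagonal.mem_antidiagonal] at hx hy
      simp only at hx hy ⊢
      rw [coeff_seqL, hq]
      by_cases hi : i ≤ 3
      · by_cases hl : 3 < i + l
        · have := hch 3 i l hi hl
          rw [Nat.cast_ofNat] at this
          rw [this]; simp
        · rw [if_neg (show ¬ n' ≤ m by omega), iterate_map_zero, mul_zero]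
      · rw [if_neg (by omega), if_neg (by omega), if_neg (by omega), zero_mul, zero_mul]
    · rintro ⟨i, n⟩ hx
      refine Finset.sum_eq_zero ?_
      rintro ⟨l, n'⟩ hy
      rw [HasAntidiagonal.mem_antidiagonal] at hx hy
      simp only at hx hy ⊢
      rw [coeff_seqL, hq]
      by_cases hi : i ≤ m
      · by_cases hl : m < i + l
        · rw [hch m i l hi hl]; simp
        · rw [if_neg (show ¬ n' = 0 by omega), if_neg (show ¬ n' = 2 by omega),
            if_neg (show ¬ n' = 3 by omega), iterate_map_zero, mul_zero]
      · rw [if_neg hi, zero_mul, zero_mul]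

theorem PsiDO.IsCubeRoot.commCoeff_posPart {U : Set ℝ} {P : PsiDO} {u₁ u₀ : ℝ → ℂ}
    (h : PsiDO.IsCubeRoot U P (opL u₁ u₀)) (hU : IsOpen U) (hu₁ : ContDiffOn ℝ (⊤ : ℕ∞) u₁ U)
    (hu₀ : ContDiffOn ℝ (⊤ : ℕ∞) u₀ U) (m : ℕ) (n : ℤ) {x : ℝ} (hx : x ∈ U) :
    commCoeff (P.pow m).posPart (opL u₁ u₀) n x =
      if n = 1 then 3 * deriv ((P.pow m).coeff (m + 1)) x else
      if n = 0 then 3 * deriv (fun ξ => deriv ((P.pow m).coeff (m + 1)) ξ +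
        (P.pow m).coeff (m + 2) ξ) x else 0 := by
  have hL : (opL u₁ u₀).SmoothAt x :=
    smoothAt_opL (hu₁.contDiffAt (hU.mem_nhds hx)) (hu₀.contDiffAt (hU.mem_nhds hx))
  have hP := (h.smoothAt hU hx).pow m
  have hord : (P.pow m).posPart.order = m := order_pow h.order_eq m
  have hpos : (P.pow m).posPart.SmoothAt x := by
    intro i
    simp only [posPart]
    split_ifs
    · exact hP i
    · exact contDiffAt_const
  have hq : ∀ i, PowerSeries.coeff i (jetSeq x (P.pow m).posPart) =
      if i ≤ m then PowerSeries.coeff i (seqPow (jetSeq x P) m) else 0 := by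
    intro i
    rw [← jetSeq_pow h.order_eq (h.smoothAt hU hx), coeff_jetSeq, coeff_jetSeq, posPart,
      order_pow h.order_eq]
    simp only [Nat.cast_le]
    split_ifs
    · rfl
    · rw [jet_const, map_zero]
  have hval : ∀ (Q : PsiDO) (i : ℕ), Q.coeff i x =
      constantCoeff (PowerSeries.coeff i (jetSeq x Q)) := fun Q i => by
    rw [coeff_jetSeq, constantCoeff_jet]
  have h3 : ∀ r : ℂ⟦X⟧, constantCoeff (3 * r) = 3 * constantCoeff r := fun r => by
    rw [map_mul, map_ofNat]
  have ho1 : (PsiDO.mul (P.pow m).posPart (opL u₁ u₀)).order = m + 3 := by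
    change (P.pow m).posPart.order + 3 = _; rw [hord]
  have ho2 : (PsiDO.mul (opL u₁ u₀) (P.pow m).posPart).order = m + 3 := by
    change 3 + (P.pow m).posPart.order = _; rw [hord, add_comm]
  rw [commCoeff, coeffAt, coeffAt, ho1, ho2]
  by_cases hn : n ≤ m + 3
  · have hj := coeff_comm_posPart (h.seqPow_three hU hx) m ((m : ℤ) + 3 - n).toNat hq
    rw [if_pos hn, if_pos hn, hval, hval, ← map_sub, ← map_sub, jetSeq_mul hpos hL,
      jetSeq_mul hL hpos, hord, jetSeq_opL, show (opL u₁ u₀).order = 3 from rfl, hj,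
      ← jetSeq_pow h.order_eq (h.smoothAt hU hx), coeff_jetSeq, coeff_jetSeq]
    by_cases h1 : n = 1
    · rw [if_pos (by omega), if_pos h1, h3, ← jet_deriv, constantCoeff_jet]
    by_cases h0 : n = 0
    · rw [if_neg (by omega), if_pos (by omega), if_neg h1, if_pos h0, h3, ← jet_deriv,
        ← jet_add (contDiffAt_deriv (hP _)) (hP _), ← jet_deriv, constantCoeff_jet]
    · rw [if_neg (by omega), if_neg (by omega), if_neg h1, if_neg h0, map_zero]
  · rw [if_neg hn, if_neg hn, sub_zero, if_neg (by omega), if_neg (by omega)]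

end Boussinesq

end

noncomputable section

/-! ### Existence of the cube root -/

namespace Boussinesq

open Finset

namespace PsiDO

theorem mul_coeff_zero (A B : PsiDO) (x : ℝ) :
    (mul A B).coeff 0 x = A.coeff 0 x * B.coeff 0 x := by
  simp [mul]

theorem mul_coeff_congr {A A' B B' : PsiDO} (ho : A.order = A'.order) {n : ℕ}
    (hA : ∀ i ≤ n, A.coeff i = A'.coeff i) (hB : ∀ i ≤ n, B.coeff i = B'.coeff i) :
    (mul A B).coeff n = (mul A' B').coeff n := by
  ext x
  simp only [mul]
  refine Finset.sum_congr rfl fun y hy => Finset.sum_congr rfl fun z hz => ?_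
  rw [HasAntidiagonal.mem_antidiagonal] at hy hz
  rw [hA _ (by omega), hB _ (by omega), ho]

theorem mul_coeff_sub {A A' B B' : PsiDO} (ho : A.order = A'.order) {n : ℕ} (hn : 1 ≤ n)
    (hA : ∀ i < n, A.coeff i = A'.coeff i) (hB : ∀ i < n, B.coeff i = B'.coeff i) (x : ℝ) :
    (mul A B).coeff n x - (mul A' B').coeff n x =
      A.coeff 0 x * (B.coeff n x - B'.coeff n x) +
        (A.coeff n x - A'.coeff n x) * B.coeff 0 x := by
  simp only [mul]
  rw [← Finset.sum_sub_distrib, Finset.sum_eq_add (0, n) (n, 0)]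
  · congr 1
    · rw [← Finset.sum_sub_distrib, Finset.sum_eq_single (0, n)]
      · simp [hA 0 (by omega)]; ring
      · rintro ⟨l, j⟩ hy hne
        rw [HasAntidiagonal.mem_antidiagonal] at hy
        simp only at hy ⊢
        have : j < n := by
          by_contra hc
          apply hne
          ext <;> simp <;> omega
        rw [hA 0 (by omega), hB j this, ho, sub_self]
      · intro h; simp at h
    · simp [hB 0 (by omega)]; ring
  · intro h
    rw [Prod.mk.injEq] at h
    omega
  · rintro ⟨i, m⟩ hx ⟨h1, h2⟩
    rw [HasAntidiagonal.mem_antidiagonal] at hx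
    rw [← Finset.sum_sub_distrib]
    refine Finset.sum_eq_zero ?_
    rintro ⟨l, j⟩ hy
    rw [HasAntidiagonal.mem_antidiagonal] at hy
    simp only at hx hy ⊢
    have hi0 : i ≠ 0 := by
      rintro rfl; apply h1; ext <;> simp; omega
    have hin : i ≠ n := by
      rintro rfl; apply h2; ext <;> simp; omega
    rw [hA i (by omega), hB j (by omega), ho, sub_self]
  · intro h; simp at h
  · intro h; simp at h

theorem pow_three (P : PsiDO) : pow P 3 = mul (mul (mul one P) P) P := rfl

/-- In the cube of a monic operator, the newest coefficient occurs linearly with factor 3;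
everything else depends on earlier ones. This is what lets `cubeRootCoeff` solve for coefficients
one at a time. -/
theorem pow_three_coeff_sub {P P' : PsiDO} (ho : P.order = P'.order) (h0 : P.coeff 0 = fun _ => 1)
    {n : ℕ} (hn : 1 ≤ n) (hp : ∀ i < n, P.coeff i = P'.coeff i) (x : ℝ) :
    (pow P 3).coeff n x - (pow P' 3).coeff n x = 3 * (P.coeff n x - P'.coeff n x) := by
  have order_mul : ∀ A B : PsiDO, (mul A B).order = A.order + B.order := fun _ _ => rfl
  have o1 : (mul one P).order = (mul one P').order := by rw [order_mul, order_mul, ho]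
  have o2 : (mul (mul one P) P).order = (mul (mul one P') P').order := by
    simp only [order_mul, ho]
  have l1 : ∀ i < n, (mul one P).coeff i = (mul one P').coeff i := fun i hi =>
    mul_coeff_congr rfl (fun _ _ => rfl) fun j hj => hp j (by omega)
  have l2 : ∀ i < n, (mul (mul one P) P).coeff i = (mul (mul one P') P').coeff i := fun i hi =>
    mul_coeff_congr o1 (fun j hj => l1 j (by omega)) fun j hj => hp j (by omega)
  have z0 : one.coeff 0 x = 1 := by simp [one]
  have z1 : (mul one P).coeff 0 x = 1 := by rw [mul_coeff_zero, z0, h0, one_mul]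
  have z2 : (mul (mul one P) P).coeff 0 x = 1 := by rw [mul_coeff_zero, z1, h0, one_mul]
  rw [pow_three, pow_three, mul_coeff_sub o2 hn l2 hp, mul_coeff_sub o1 hn l1 hp,
    mul_coeff_sub (A := one) (A' := one) rfl hn (fun _ _ => rfl) hp, z2, z1, z0, h0]
  ring

/-- The coefficients of the cube root of a monic operator `L` of order `3`. -/
def cubeRootCoeff (L : PsiDO) : ℕ → ℝ → ℂ
  | 0 => fun _ => 1
  | n + 1 => fun x => (L.coeff (n + 1) x -
      (pow ⟨1, fun i => if _ : i < n + 1 then cubeRootCoeff L i else 0⟩ 3).coeff (n + 1) x) / 3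

theorem pow_three_cubeRootCoeff {L : PsiDO} (hL : L.coeff 0 = fun _ => 1) (n : ℕ) (x : ℝ) :
    (pow ⟨1, cubeRootCoeff L⟩ 3).coeff n x = L.coeff n x := by
  have h0 : cubeRootCoeff L 0 = fun _ => 1 := by rw [cubeRootCoeff]
  cases n with
  | zero =>
    rw [pow_three, mul_coeff_zero, mul_coeff_zero, mul_coeff_zero]
    simp [one, h0, hL]
  | succ n =>
    have h := pow_three_coeff_sub (P := ⟨1, cubeRootCoeff L⟩)
      (P' := ⟨1, fun i => if _ : i < n + 1 then cubeRootCoeff L i else 0⟩)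
      rfl h0 (show 1 ≤ n + 1 by omega) (fun i hi => by simp only [dif_pos hi]) x
    have hz : (if _ : n + 1 < n + 1 then cubeRootCoeff L (n + 1) else 0) x = 0 := by
      rw [dif_neg (lt_irrefl _)]; rfl
    have e : cubeRootCoeff L (n + 1) x = (L.coeff (n + 1) x -
      (pow ⟨1, fun i => if _ : i < n + 1 then cubeRootCoeff L i else 0⟩ 3).coeff (n + 1) x) / 3 := by
      rw [cubeRootCoeff]
    simp only [hz] at h
    linear_combination h + 3 * e

theorem smoothAt_cubeRootCoeff {L : PsiDO} {x : ℝ} (hL : L.SmoothAt x) (n : ℕ) :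
    ContDiffAt ℝ (⊤ : ℕ∞) (cubeRootCoeff L n) x := by
  induction n using Nat.strong_induction_on with
  | _ n ih =>
    cases n with
    | zero => rw [cubeRootCoeff]; exact contDiffAt_const
    | succ n =>
      rw [cubeRootCoeff]
      refine ((hL _).sub (SmoothAt.pow ?_ 3 _)).div_const 3
      intro i
      simp only
      split_ifs with hi
      · exact ih i hi
      · exact contDiffAt_const

theorem exists_isCubeRoot {U : Set ℝ} (hU : IsOpen U) {u₁ u₀ : ℝ → ℂ}
    (hu₁ : ContDiffOn ℝ (⊤ : ℕ∞) u₁ U) (hu₀ : ContDiffOn ℝ (⊤ : ℕ∞) u₀ U) :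
    ∃ P, IsCubeRoot U P (opL u₁ u₀) := by
  refine ⟨⟨1, cubeRootCoeff (opL u₁ u₀)⟩, rfl, fun x _ => by simp only [cubeRootCoeff], ?_, ?_⟩
  · intro i x hx
    exact (smoothAt_cubeRootCoeff (smoothAt_opL (hu₁.contDiffAt (hU.mem_nhds hx))
      (hu₀.contDiffAt (hU.mem_nhds hx))) i).contDiffWithinAt
  · intro n x _
    rw [coeffAt, coeffAt, order_pow rfl]
    have : (opL u₁ u₀).order = 3 := rfl
    rw [this, pow_three_cubeRootCoeff (by simp [opL])]
    simp

end PsiDO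

end Boussinesq

end

noncomputable section

/-! ### The Airy-type function -/

namespace Boussinesq

open MeasureTheory Filter Topology

/-- The integrand `ξ ^ k exp (z ξ + ξ ^ 3)`, with `ξ = 1 + i η`. -/
def airyIntegrand (k : ℕ) (z η : ℝ) : ℂ :=
  (1 + Complex.I * (η : ℂ)) ^ k *
    Complex.exp ((z : ℂ) * (1 + Complex.I * (η : ℂ)) + (1 + Complex.I * (η : ℂ)) ^ 3)

theorem continuous_airyIntegrand (k : ℕ) (z : ℝ) : Continuous (airyIntegrand k z) := by
  unfold airyIntegrand; fun_prop

/-- The exponential has modulus `exp (z + 1 - 3 η²)`, and up to three factors of `ξ` cost at most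
`exp (3 η² / 2)`. -/
theorem norm_airyIntegrand_le {k : ℕ} (hk : k ≤ 3) (z η : ℝ) :
    ‖airyIntegrand k z η‖ ≤ Real.exp (z + 1) * Real.exp (-(3 / 2) * η ^ 2) := by
  have h1 : ‖(1 : ℂ) + Complex.I * η‖ ≤ Real.exp (η ^ 2 / 2) := by
    have : ‖(1 : ℂ) + Complex.I * η‖ ^ 2 = 1 + η ^ 2 := by
      rw [← Complex.normSq_eq_norm_sq]
      simp [Complex.normSq_apply]; ring
    refine le_of_sq_le_sq ?_ (Real.exp_pos _).le
    rw [this, ← Real.exp_nat_mul]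
    have := Real.add_one_le_exp (η ^ 2)
    calc 1 + η ^ 2 ≤ Real.exp (η ^ 2) := by linarith
      _ = _ := by congr 1; push_cast; ring
  have h2 : ‖(1 : ℂ) + Complex.I * η‖ ^ k ≤ Real.exp (3 / 2 * η ^ 2) := by
    calc ‖(1 : ℂ) + Complex.I * η‖ ^ k ≤ Real.exp (η ^ 2 / 2) ^ k :=
          pow_le_pow_left₀ (norm_nonneg _) h1 k
      _ = Real.exp (k * (η ^ 2 / 2)) := by rw [Real.exp_nat_mul]
      _ ≤ _ := by
        apply Real.exp_le_exp.mpr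
        have : (k : ℝ) ≤ 3 := by exact_mod_cast hk
        nlinarith [sq_nonneg η]
  have h3 : ((z : ℂ) * (1 + Complex.I * (η : ℂ)) + (1 + Complex.I * (η : ℂ)) ^ 3).re =
      z + 1 - 3 * η ^ 2 := by
    have : ((z : ℂ) * (1 + Complex.I * (η : ℂ)) + (1 + Complex.I * (η : ℂ)) ^ 3) =
        ((z + 1 - 3 * η ^ 2 : ℝ) : ℂ) + ((z * η + 3 * η - η ^ 3 : ℝ) : ℂ) * Complex.I := by
      push_cast
      linear_combination (3 * (η : ℂ) ^ 2 + Complex.I * (η : ℂ) ^ 3) * Complex.I_sq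
    rw [this, Complex.add_re, Complex.ofReal_re, Complex.re_ofReal_mul, Complex.I_re, mul_zero,
      add_zero]
  rw [airyIntegrand, norm_mul, norm_pow, Complex.norm_exp, h3]
  calc _ ≤ Real.exp (3 / 2 * η ^ 2) * Real.exp (z + 1 - 3 * η ^ 2) :=
        mul_le_mul_of_nonneg_right h2 (Real.exp_pos _).le
    _ = _ := by rw [← Real.exp_add, ← Real.exp_add]; congr 1; ring

theorem integrable_airyIntegrand {k : ℕ} (hk : k ≤ 3) (z : ℝ) :
    Integrable (airyIntegrand k z) := by
  refine Integrable.mono' ((integrable_exp_neg_mul_sq (b := 3 / 2) (by norm_num)).const_mul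
    (Real.exp (z + 1))) (continuous_airyIntegrand k z).aestronglyMeasurable
    (Eventually.of_forall fun η => ?_)
  exact norm_airyIntegrand_le hk z η

theorem hasDerivAt_airyIntegrand (k : ℕ) (z η : ℝ) :
    HasDerivAt (fun z => airyIntegrand k z η) (airyIntegrand (k + 1) z η) z := by
  have h : HasDerivAt (fun z : ℝ => (z : ℂ) * (1 + Complex.I * (η : ℂ)) +
      (1 + Complex.I * (η : ℂ)) ^ 3) (1 * (1 + Complex.I * (η : ℂ))) z :=
    ((Complex.ofRealCLM.hasDerivAt (x := z)).mul_const _).add_const _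
  have := (h.cexp).const_mul ((1 + Complex.I * (η : ℂ)) ^ k)
  refine this.congr_deriv ?_
  rw [airyIntegrand]; ring

theorem hasDerivAt_integral_airyIntegrand {k : ℕ} (hk : k + 1 ≤ 3) (z : ℝ) :
    HasDerivAt (fun z => ∫ η, airyIntegrand k z η) (∫ η, airyIntegrand (k + 1) z η) z := by
  refine (hasDerivAt_integral_of_dominated_loc_of_deriv_le
    (F := fun z η => airyIntegrand k z η) (F' := fun z η => airyIntegrand (k + 1) z η)
    (bound := fun η => Real.exp (z + 1 + 1) * Real.exp (-(3 / 2) * η ^ 2))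
    (Metric.ball_mem_nhds z one_pos) ?_ (integrable_airyIntegrand (by omega) z) ?_ ?_ ?_ ?_).2
  · exact Eventually.of_forall fun z => (continuous_airyIntegrand k z).aestronglyMeasurable
  · exact (continuous_airyIntegrand (k + 1) z).aestronglyMeasurable
  · refine Eventually.of_forall fun η w hw => (norm_airyIntegrand_le hk w η).trans ?_
    refine mul_le_mul_of_nonneg_right (Real.exp_le_exp.mpr ?_) (Real.exp_pos _).le
    rw [Metric.mem_ball, Real.dist_eq] at hw
    linarith [(abs_lt.mp hw).2]
  · exact (integrable_exp_neg_mul_sq (by norm_num)).const_mul _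
  · exact Eventually.of_forall fun η w _ => hasDerivAt_airyIntegrand k w η

/-- The integral of the total derivative `d/dη exp (z ξ + ξ³)` vanishes; this is the equation `3 A''
= -z A`. -/
theorem integral_airyIntegrand_two (z : ℝ) :
    3 * ∫ η, airyIntegrand 2 z η = -(z : ℂ) * ∫ η, airyIntegrand 0 z η := by
  have hd : ∀ η : ℝ, HasDerivAt (fun η : ℝ => airyIntegrand 0 z η)
      (Complex.I * (z * airyIntegrand 0 z η + 3 * airyIntegrand 2 z η)) η := by
    intro η
    have h0 : HasDerivAt (fun η : ℝ => 1 + Complex.I * (η : ℂ)) (Complex.I * 1) η :=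
      ((Complex.ofRealCLM.hasDerivAt (x := η)).const_mul Complex.I).const_add 1
    have h := ((h0.const_mul (z : ℂ)).add (h0.pow 3)).cexp.const_mul (1 : ℂ)
    refine (h.congr_deriv ?_).congr_of_eventuallyEq ?_
    · simp only [airyIntegrand, Pi.add_apply, Pi.pow_apply]; push_cast; ring
    · exact Eventually.of_forall fun η => by simp [airyIntegrand]
  have h0 := integrable_airyIntegrand (k := 0) (by norm_num) z
  have h2 := integrable_airyIntegrand (k := 2) (by norm_num) z
  have hi : Integrable fun η : ℝ =>
      Complex.I * (z * airyIntegrand 0 z η + 3 * airyIntegrand 2 z η) :=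
    ((h0.const_mul _).add (h2.const_mul _)).const_mul _
  have := integral_eq_zero_of_hasDerivAt_of_integrable hd hi h0
  rw [integral_const_mul, integral_add (h0.const_mul _) (h2.const_mul _), integral_const_mul,
    integral_const_mul] at this
  have h := (mul_eq_zero.mp this).resolve_left Complex.I_ne_zero
  linear_combination h

theorem airyA_eq (z : ℝ) :
    airyA z = (1 / (2 * (Real.pi : ℂ))) * ∫ η, airyIntegrand 0 z η := by
  simp [airyA, airyIntegrand]

theorem hasDerivAt_airyA_aux (z : ℝ) :
    HasDerivAt airyA ((1 / (2 * (Real.pi : ℂ))) * ∫ η, airyIntegrand 1 z η) z := by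
  have : airyA = fun z => (1 / (2 * (Real.pi : ℂ))) * ∫ η, airyIntegrand 0 z η :=
    funext airyA_eq
  rw [this]
  exact (hasDerivAt_integral_airyIntegrand (k := 0) (by norm_num) z).const_mul _

theorem hasDerivAt_airyA (z : ℝ) : HasDerivAt airyA (deriv airyA z) z :=
  (hasDerivAt_airyA_aux z).differentiableAt.hasDerivAt

theorem hasDerivAt_deriv_airyA (z : ℝ) :
    HasDerivAt (deriv airyA) (-((z : ℂ) / 3) * airyA z) z := by
  have : deriv airyA = fun z => (1 / (2 * (Real.pi : ℂ))) * ∫ η, airyIntegrand 1 z η :=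
    funext fun z => (hasDerivAt_airyA_aux z).deriv
  rw [this]
  refine ((hasDerivAt_integral_airyIntegrand (k := 1) (by norm_num) z).const_mul _).congr_deriv ?_
  rw [airyA_eq]
  linear_combination (1 / (2 * (Real.pi : ℂ))) / 3 * integral_airyIntegrand_two z

/-- Up to nonzero factors, `airyA` is the Fourier transform of the continuous integrable function
`exp ((1 + i η)³)`. If it vanished, Fourier inversion would make an exponential zero. -/
theorem airyA_ne_zero : airyA ≠ 0 := by
  intro h
  have hI : ∀ z, ∫ η, airyIntegrand 0 z η = 0 := by
    intro z
    have := congrFun h z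
    rw [airyA_eq, Pi.zero_apply, mul_eq_zero] at this
    refine this.resolve_left ?_
    simp [Real.pi_ne_zero]
  have hF : FourierTransform.fourier (airyIntegrand 0 0) = 0 := by
    ext w
    rw [Real.fourier_eq', Pi.zero_apply]
    have h2 := hI (-2 * Real.pi * w)
    have h3 : ∀ η : ℝ, airyIntegrand 0 (-2 * Real.pi * w) η =
        Complex.exp (-2 * Real.pi * w) * (Complex.exp ((((-2 * Real.pi * inner ℝ η w : ℝ)) : ℂ) *
          Complex.I) • airyIntegrand 0 0 η) := by
      intro η
      simp only [airyIntegrand, pow_zero, one_mul, smul_eq_mul, ← Complex.exp_add]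
      congr 1
      simp
      ring
    simp only [h3] at h2
    rw [integral_const_mul] at h2
    exact (mul_eq_zero.mp h2).resolve_left (Complex.exp_ne_zero _)
  have := (continuous_airyIntegrand 0 0).fourierInv_fourier_eq
    (integrable_airyIntegrand (by norm_num) 0) (by rw [hF]; exact integrable_zero _ _ _)
  rw [hF] at this
  have h1 := congrFun this 0
  rw [Real.fourierInv_eq'] at h1
  simp only [Pi.zero_apply, smul_zero, integral_zero] at h1
  simp only [airyIntegrand, pow_zero, one_mul] at h1
  exact Complex.exp_ne_zero _ h1.symm

/-- A common zero would force `A = 0` everywhere, by uniqueness for the linear system satisfied by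
`(A, A')`. The interval is bounded so that the field is Lipschitz uniformly in time. -/
theorem airyA_or_deriv_ne_zero (w : ℝ) : airyA w ≠ 0 ∨ deriv airyA w ≠ 0 := by
  by_contra! hc
  obtain ⟨h1, h2⟩ := hc
  apply airyA_ne_zero
  ext t
  set M : ℝ := |t| + |w| + 1 with hM
  have ht : t ∈ Set.Ioo (-M) M := by
    constructor <;> linarith [neg_abs_le t, le_abs_self t, abs_nonneg w]
  have hw : w ∈ Set.Ioo (-M) M := by
    constructor <;> linarith [neg_abs_le w, le_abs_self w, abs_nonneg t]
  have hM0 : 0 ≤ M := by positivity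
  let v : ℝ → ℂ × ℂ → ℂ × ℂ := fun s y => (y.2, -((s : ℂ) / 3) * y.1)
  have hv : ∀ s ∈ Set.Ioo (-M) M, LipschitzOnWith (Real.toNNReal (1 + M)) (v s) Set.univ := by
    intro s hs
    refine LipschitzOnWith.of_dist_le_mul fun a _ b _ => ?_
    rw [Real.coe_toNNReal _ (by positivity)]
    have ha : ‖a.2 - b.2‖ ≤ dist a b := by rw [dist_eq_norm]; exact norm_snd_le (a - b)
    have hb : ‖a.1 - b.1‖ ≤ dist a b := by rw [dist_eq_norm]; exact norm_fst_le (a - b)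
    have hd : 0 ≤ dist a b := dist_nonneg
    rw [dist_eq_norm, Prod.norm_def]
    refine max_le ?_ ?_
    · simp only [v, Prod.fst_sub]
      nlinarith
    · simp only [v, Prod.snd_sub]
      rw [← mul_sub, norm_mul, norm_neg, norm_div, Complex.norm_real]
      have hs' : ‖s‖ ≤ M := abs_le.mpr ⟨hs.1.le, hs.2.le⟩
      have : ‖s‖ / ‖(3 : ℂ)‖ ≤ 1 + M := by
        rw [Complex.norm_ofNat]; linarith [norm_nonneg s]
      exact mul_le_mul this hb (norm_nonneg _) (by positivity)
  have := ODE_solution_unique_of_mem_Ioo (v := v) (s := fun _ => Set.univ)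
    (f := fun s => (airyA s, deriv airyA s)) (g := fun _ => (0, 0)) hv hw
    (fun s _ => ⟨(hasDerivAt_airyA s).prodMk (hasDerivAt_deriv_airyA s), trivial⟩)
    (fun s _ => ⟨by
      simp only [v, mul_zero]
      exact hasDerivAt_const s ((0 : ℂ), (0 : ℂ)), trivial⟩)
    (by simp [h1, h2]) ht
  exact congrArg Prod.fst this

/-! ### Linear independence over polynomials of `A` and `A'` -/

section

open Polynomial

/-- A parity argument on degrees: `P²` has even degree and `X Q²` odd degree, while the terms with
derivatives have too low a degree to cancel the larger of the two. -/
theorem polynomial_eq_zero_of_riccati {P Q : ℂ[X]}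
    (h : P * (P + derivative Q) - Q * (derivative P - C (1 / 3) * X * Q) = 0) :
    P = 0 ∧ Q = 0 := by
  have e : P * P = Q * derivative P - P * derivative Q - C (1 / 3) * (X * (Q * Q)) := by
    linear_combination h
  by_cases hQ : Q = 0
  · subst hQ
    simp only [derivative_zero, mul_zero, zero_mul, sub_zero] at e
    exact ⟨mul_self_eq_zero.mp e, rfl⟩
  exfalso
  set p := P.natDegree with hp
  set q := Q.natDegree with hq
  have d1 : (Q * derivative P).natDegree ≤ q + (p - 1) :=
    natDegree_mul_le.trans (add_le_add le_rfl (natDegree_derivative_le P))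
  have d2 : (P * derivative Q).natDegree ≤ p + (q - 1) :=
    natDegree_mul_le.trans (add_le_add le_rfl (natDegree_derivative_le Q))
  have hPP : (P * P).natDegree ≤ p + p := natDegree_mul_le
  have hQQ : (Q * Q).natDegree ≤ q + q := natDegree_mul_le
  by_cases hpq : q < p
  · have hc := congrArg (fun f => coeff f (p + p)) e
    simp only [coeff_sub, coeff_C_mul] at hc
    obtain ⟨s, hs⟩ : ∃ s, p + p = s + 1 := ⟨p + p - 1, by omega⟩
    rw [coeff_eq_zero_of_natDegree_lt (p := Q * derivative P) (by omega),
      coeff_eq_zero_of_natDegree_lt (p := P * derivative Q) (by omega), hs, coeff_X_mul,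
      coeff_eq_zero_of_natDegree_lt (p := Q * Q) (by omega), ← hs, hp,
      coeff_mul_degree_add_degree] at hc
    have hP : P ≠ 0 := by rintro rfl; simp at hp; omega
    simp [hP] at hc
  · have hc := congrArg (fun f => coeff f (q + q + 1)) e
    simp only [coeff_sub, coeff_C_mul, coeff_X_mul] at hc
    rw [coeff_eq_zero_of_natDegree_lt (p := Q * derivative P) (by omega),
      coeff_eq_zero_of_natDegree_lt (p := P * derivative Q) (by omega),
      coeff_eq_zero_of_natDegree_lt (p := P * P) (by omega), hq,
      coeff_mul_degree_add_degree] at hc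
    simp [hQ] at hc

/-- Differentiating `P A + Q A' = 0` gives a second linear relation for `(A, A')`. This vector never
vanishes, so the determinant does, and the determinant is the polynomial of
`polynomial_eq_zero_of_riccati`. -/
theorem polynomial_eq_zero_of_airy {P Q : ℂ[X]} {S : Set ℝ} (hS : IsOpen S) (hinf : S.Infinite)
    (h : ∀ w ∈ S, P.eval (w : ℂ) * airyA w + Q.eval (w : ℂ) * deriv airyA w = 0) :
    P = 0 ∧ Q = 0 := by
  apply polynomial_eq_zero_of_riccati
  have hder : ∀ (F : ℂ[X]) (w : ℝ),
      HasDerivAt (fun w : ℝ => F.eval (w : ℂ)) ((derivative F).eval (w : ℂ)) w := fun F w =>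
    (F.hasDerivAt (w : ℂ)).comp_ofReal
  refine eq_zero_of_infinite_isRoot _ ((hinf.image Complex.ofReal_injective.injOn).mono ?_)
  rintro _ ⟨w, hw, rfl⟩
  have h1 := h w hw
  have h2 : (derivative P).eval (w : ℂ) * airyA w + P.eval (w : ℂ) * deriv airyA w +
      ((derivative Q).eval (w : ℂ) * deriv airyA w +
        Q.eval (w : ℂ) * (-((w : ℂ) / 3) * airyA w)) = 0 := by
    have hd := ((hder P w).mul (hasDerivAt_airyA w)).add
      ((hder Q w).mul (hasDerivAt_deriv_airyA w))
    refine hd.unique ((hasDerivAt_const w (0 : ℂ)).congr_of_eventuallyEq ?_)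
    filter_upwards [hS.mem_nhds hw] with x hx using h x hx
  simp only [Set.mem_ofPred_eq, IsRoot, eval_sub, eval_mul, eval_add, eval_C, eval_X]
  rcases airyA_or_deriv_ne_zero w with h3 | h3
  · refine (mul_eq_zero.mp ?_).resolve_right h3
    linear_combination (P.eval (w : ℂ) + (derivative Q).eval (w : ℂ)) * h1 - Q.eval (w : ℂ) * h2
  · refine (mul_eq_zero.mp ?_).resolve_right h3
    linear_combination P.eval (w : ℂ) * h2 -
      ((derivative P).eval (w : ℂ) - (w : ℂ) / 3 * Q.eval (w : ℂ)) * h1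

end

end Boussinesq

end

noncomputable section

/-! ### The functions in the heat kernel expansion -/

namespace Boussinesq

open Filter Topology Finset

theorem airyTerm_zero_eq {t : ℝ} (ht : 0 < t) (x y : ℝ) :
    airyTerm 0 x y t = ((t ^ ((1 : ℝ) / 3) : ℝ) : ℂ)⁻¹ * airyA ((x - y) / t ^ ((1 : ℝ) / 3)) := by
  have : t ^ (-(1 / 3) : ℝ) = (t ^ ((1 : ℝ) / 3))⁻¹ := Real.rpow_neg ht.le _
  simp only [airyTerm, Fin.val_zero, iteratedDeriv_zero, CharP.cast_eq_zero, zero_add]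
  rw [neg_div, this, Complex.ofReal_inv]

theorem airyTerm_one_eq {t : ℝ} (ht : 0 < t) (x y : ℝ) :
    airyTerm 1 x y t =
      ((t ^ ((1 : ℝ) / 3) : ℝ) : ℂ)⁻¹ ^ 2 * deriv airyA ((x - y) / t ^ ((1 : ℝ) / 3)) := by
  have : t ^ (-(1 + 1) / 3 : ℝ) = ((t ^ ((1 : ℝ) / 3))⁻¹) ^ 2 := by
    rw [← Real.rpow_neg ht.le, ← Real.rpow_natCast, ← Real.rpow_mul ht.le]
    congr 1; norm_num
  simp only [airyTerm, Fin.val_one, iteratedDeriv_one, Nat.cast_one]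
  rw [this]; push_cast; rfl

theorem rpow_third_cubed {t : ℝ} (ht : 0 < t) : (t ^ ((1 : ℝ) / 3)) ^ 3 = t := by
  rw [← Real.rpow_natCast, ← Real.rpow_mul ht.le]; norm_num

/-- For fixed `z = x - y ≠ 0` set `w = z / t ^ (1 / 3)`, so that `t = (z / w)³`. Multiplying by a
power of `w` turns the relation into a polynomial one between `A(w)` and `A'(w)`, from which the
coefficients are read off. -/
theorem airyTerm_independent {x y : ℝ} (hxy : x ≠ y) {N : ℕ} {α β : ℕ → ℂ}
    (h : ∀ t : ℝ, 0 < t → (∑ k ∈ range N, α k * (t : ℂ) ^ k) * airyTerm 0 x y t +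
      (∑ k ∈ range N, β k * (t : ℂ) ^ k) * airyTerm 1 x y t = 0) {k : ℕ} (hk : k < N) :
    α k = 0 ∧ β k = 0 := by
  set z : ℝ := x - y with hz
  have hz0 : z ≠ 0 := sub_ne_zero.mpr hxy
  have hzc : (z : ℂ) ≠ 0 := by exact_mod_cast hz0
  -- The values of `w` reached by `t > 0`: the half-line with the sign of `z`.
  let S : Set ℝ := {w | 0 < w * z}
  have hS : IsOpen S := isOpen_lt continuous_const (by fun_prop)
  have hinf : S.Infinite := by
    refine Set.infinite_of_injective_forall_mem (f := fun n : ℕ => ((n : ℝ) + 1) * z) ?_ ?_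
    · intro a b hab
      have := mul_right_cancel₀ hz0 hab
      simpa using this
    · intro n
      change 0 < ((n : ℝ) + 1) * z * z
      have : 0 < z * z := mul_self_pos.mpr hz0
      rw [mul_assoc]; positivity
  let P : Polynomial ℂ := ∑ k ∈ range N,
    Polynomial.C (α k * (z : ℂ) ^ (3 * k)) * Polynomial.X ^ (3 * (N - k))
  let Q : Polynomial ℂ := ∑ k ∈ range N,
    Polynomial.C (β k * (z : ℂ) ^ (3 * k)) * Polynomial.X ^ (3 * (N - k) + 1)
  have hPQ : Polynomial.C (z : ℂ) * P = 0 ∧ Q = 0 := by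
    refine polynomial_eq_zero_of_airy hS hinf fun w hw => ?_
    have hw' : 0 < w * z := hw
    have hw0 : w ≠ 0 := by rintro rfl; simp at hw'
    have hwc : (w : ℂ) ≠ 0 := by exact_mod_cast hw0
    have hc : 0 < z / w := by
      rw [div_eq_mul_inv, ← mul_pos_iff_of_pos_left hw',
        show w * z * (z * w⁻¹) = z * z by field_simp]
      exact mul_self_pos.mpr hz0
    have hroot : ((z / w) ^ 3) ^ ((1 : ℝ) / 3) = z / w := by
      rw [← Real.rpow_natCast, ← Real.rpow_mul hc.le]; norm_num
    have ht : 0 < (z / w) ^ 3 := by positivity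
    have key := h _ ht
    rw [airyTerm_zero_eq ht, airyTerm_one_eq ht, hroot, ← hz,
      show z / (z / w) = w by field_simp] at key
    have e : ∀ γ : ℕ → ℂ, (w : ℂ) ^ (3 * N) * ∑ k ∈ range N, γ k * (((z / w) ^ 3 : ℝ) : ℂ) ^ k =
        ∑ k ∈ range N, γ k * (z : ℂ) ^ (3 * k) * (w : ℂ) ^ (3 * (N - k)) := by
      intro γ
      rw [mul_sum]
      refine Finset.sum_congr rfl fun k hk => ?_
      rw [mem_range] at hk
      have : (w : ℂ) ^ (3 * N) = (w : ℂ) ^ (3 * (N - k)) * (w : ℂ) ^ (3 * k) := by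
        rw [← pow_add]; congr 1; omega
      rw [this]
      push_cast
      rw [← pow_mul, div_pow]
      field_simp
    have eP : P.eval (w : ℂ) =
        (w : ℂ) ^ (3 * N) * ∑ k ∈ range N, α k * (((z / w) ^ 3 : ℝ) : ℂ) ^ k := by
      rw [e]; simp [P, Polynomial.eval_finsetSum]
    have eQ : Q.eval (w : ℂ) =
        w * ((w : ℂ) ^ (3 * N) * ∑ k ∈ range N, β k * (((z / w) ^ 3 : ℝ) : ℂ) ^ k) := by
      rw [e, mul_sum]; simp only [Q, Polynomial.eval_finsetSum]
      refine Finset.sum_congr rfl fun k _ => ?_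
      simp only [Polynomial.eval_mul, Polynomial.eval_C, Polynomial.eval_pow, Polynomial.eval_X]
      ring
    rw [Polynomial.eval_mul, Polynomial.eval_C, eP, eQ]
    have : (((z / w : ℝ) : ℂ))⁻¹ = w / z := by push_cast; rw [inv_div]
    rw [this] at key
    -- The factors `w / z` of `A` and `(w / z)²` of `A'` are cleared, which explains the `C z` in
    -- front of `P` and the extra power of `w` in `Q`.
    have h2 := congrArg (fun c => (w : ℂ) ^ (3 * N) * (z : ℂ) ^ 2 / w * c) key
    simp only [mul_zero] at h2
    rw [← h2]
    field_simp
  have hzk : (z : ℂ) ^ (3 * k) ≠ 0 := pow_ne_zero _ hzc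
  constructor
  · have hP : P = 0 := by
      refine (mul_eq_zero.mp hPQ.1).resolve_left ?_
      exact fun h0 => hzc (Polynomial.C_eq_zero.mp h0)
    have := congrArg (fun F => Polynomial.coeff F (3 * (N - k))) hP
    simp only [P, Polynomial.finsetSum_coeff, Polynomial.coeff_C_mul_X_pow,
      Polynomial.coeff_zero] at this
    rw [Finset.sum_eq_single k] at this
    · simpa [hzk, hzc] using this
    · intro j hj hne
      rw [mem_range] at hj
      rw [if_neg (by omega)]
    · intro hj; simp only [mem_range] at hj; omega
  · have := congrArg (fun F => Polynomial.coeff F (3 * (N - k) + 1)) hPQ.2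
    simp only [Q, Polynomial.finsetSum_coeff, Polynomial.coeff_C_mul_X_pow,
      Polynomial.coeff_zero] at this
    rw [Finset.sum_eq_single k] at this
    · simpa [hzk, hzc] using this
    · intro j hj hne
      rw [mem_range] at hj
      rw [if_neg (by omega)]
    · intro hj; simp only [mem_range] at hj; omega

theorem hasDerivAt_airyTerm_zero {t : ℝ} (ht : 0 < t) (x y : ℝ) :
    HasDerivAt (fun ξ => airyTerm 0 ξ y t) (airyTerm 1 x y t) x := by
  have h1 : HasDerivAt (fun ξ : ℝ => (ξ - y) / t ^ ((1 : ℝ) / 3)) (1 / t ^ ((1 : ℝ) / 3)) x :=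
    ((hasDerivAt_id x).sub_const y).div_const _
  have h2 := ((hasDerivAt_airyA _).scomp x h1).const_mul ((t ^ ((1 : ℝ) / 3) : ℝ) : ℂ)⁻¹
  refine (h2.congr_deriv ?_).congr_of_eventuallyEq
    (Eventually.of_forall fun ξ => airyTerm_zero_eq ht ξ y)
  rw [airyTerm_one_eq ht, Complex.real_smul]
  push_cast; ring

theorem hasDerivAt_airyTerm_one {t : ℝ} (ht : 0 < t) (x y : ℝ) :
    HasDerivAt (fun ξ => airyTerm 1 ξ y t)
      (-(((x : ℂ) - y) / (3 * t)) * airyTerm 0 x y t) x := by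
  have h1 : HasDerivAt (fun ξ : ℝ => (ξ - y) / t ^ ((1 : ℝ) / 3)) (1 / t ^ ((1 : ℝ) / 3)) x :=
    ((hasDerivAt_id x).sub_const y).div_const _
  have h2 := ((hasDerivAt_deriv_airyA _).scomp x h1).const_mul
    (((t ^ ((1 : ℝ) / 3) : ℝ) : ℂ)⁻¹ ^ 2)
  refine (h2.congr_deriv ?_).congr_of_eventuallyEq
    (Eventually.of_forall fun ξ => airyTerm_one_eq ht ξ y)
  rw [airyTerm_zero_eq ht, Complex.real_smul]
  have hc : (t : ℂ) = ((t ^ ((1 : ℝ) / 3) : ℝ) : ℂ) ^ 3 := by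
    exact_mod_cast (rpow_third_cubed ht).symm
  have hc0 : ((t ^ ((1 : ℝ) / 3) : ℝ) : ℂ) ≠ 0 := by
    exact_mod_cast (Real.rpow_pos_of_pos ht _).ne'
  rw [hc]
  push_cast
  field_simp

theorem hasDerivAt_rpow_third {t : ℝ} (ht : 0 < t) :
    HasDerivAt (fun τ : ℝ => τ ^ ((1 : ℝ) / 3)) (t ^ ((1 : ℝ) / 3) / (3 * t)) t := by
  refine (Real.hasDerivAt_rpow_const (Or.inl ht.ne')).congr_deriv ?_
  rw [Real.rpow_sub_one ht.ne']; field_simp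

theorem hasDerivAt_airyTerm_zero_time {t : ℝ} (ht : 0 < t) (x y : ℝ) :
    HasDerivAt (fun τ => airyTerm 0 x y τ)
      (-(1 / (3 * (t : ℂ))) * (airyTerm 0 x y t + ((x : ℂ) - y) * airyTerm 1 x y t)) t := by
  have hr := hasDerivAt_rpow_third ht
  have hpos := Real.rpow_pos_of_pos ht ((1 : ℝ) / 3)
  have hc0 : ((t ^ ((1 : ℝ) / 3) : ℝ) : ℂ) ≠ 0 := by exact_mod_cast hpos.ne'
  have ht0 : (t : ℂ) ≠ 0 := by exact_mod_cast ht.ne'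
  have h1 := (hr.ofReal_comp).fun_inv hc0
  have h2 := (hasDerivAt_const t (x - y)).fun_div hr hpos.ne'
  have h3 := h1.fun_mul ((hasDerivAt_airyA _).scomp t h2)
  refine (h3.congr_deriv ?_).congr_of_eventuallyEq ?_
  · rw [airyTerm_zero_eq ht, airyTerm_one_eq ht, Complex.real_smul]
    simp only [Function.comp]
    push_cast
    field_simp
    ring
  · filter_upwards [lt_mem_nhds ht] with τ hτ using airyTerm_zero_eq hτ x y

theorem hasDerivAt_airyTerm_one_time {t : ℝ} (ht : 0 < t) (x y : ℝ) :
    HasDerivAt (fun τ => airyTerm 1 x y τ)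
      (-(2 / (3 * (t : ℂ))) * airyTerm 1 x y t +
        ((x : ℂ) - y) ^ 2 / (9 * (t : ℂ) ^ 2) * airyTerm 0 x y t) t := by
  have hr := hasDerivAt_rpow_third ht
  have hpos := Real.rpow_pos_of_pos ht ((1 : ℝ) / 3)
  have hc0 : ((t ^ ((1 : ℝ) / 3) : ℝ) : ℂ) ≠ 0 := by exact_mod_cast hpos.ne'
  have ht0 : (t : ℂ) ≠ 0 := by exact_mod_cast ht.ne'
  have h1 := ((hr.ofReal_comp).fun_inv hc0).fun_pow 2
  have h2 := (hasDerivAt_const t (x - y)).fun_div hr hpos.ne'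
  have h3 := h1.fun_mul ((hasDerivAt_deriv_airyA _).scomp t h2)
  have hc : (t : ℂ) = ((t ^ ((1 : ℝ) / 3) : ℝ) : ℂ) ^ 3 := by
    exact_mod_cast (rpow_third_cubed ht).symm
  refine (h3.congr_deriv ?_).congr_of_eventuallyEq ?_
  · rw [airyTerm_zero_eq ht, airyTerm_one_eq ht, Complex.real_smul]
    simp only [Function.comp]
    push_cast
    set c := ((t ^ ((1 : ℝ) / 3) : ℝ) : ℂ)
    rw [hc]
    field_simp
    ring
  · filter_upwards [lt_mem_nhds ht] with τ hτ using airyTerm_one_eq hτ x y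

end Boussinesq

end

noncomputable section

/-! ### The recursion for the Hadamard coefficients -/

namespace Boussinesq

open Filter Topology Finset

theorem hasDerivAt_airyComb {t : ℝ} (ht : 0 < t) {x y : ℝ} {f g : ℝ → ℂ} {f' g' : ℂ}
    (hf : HasDerivAt f f' x) (hg : HasDerivAt g g' x) :
    HasDerivAt (fun ξ => f ξ * airyTerm 0 ξ y t + g ξ * airyTerm 1 ξ y t)
      ((f' - ((x : ℂ) - y) / (3 * t) * g x) * airyTerm 0 x y t +
        (f x + g') * airyTerm 1 x y t) x := by
  refine ((hf.fun_mul (hasDerivAt_airyTerm_zero ht x y)).fun_add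
    (hg.fun_mul (hasDerivAt_airyTerm_one ht x y))).congr_deriv ?_
  ring

theorem hasDerivAt_iteratedDeriv {O : Set ℝ} (hO : IsOpen O) {f : ℝ → ℂ}
    (hf : ContDiffOn ℝ (⊤ : ℕ∞) f O) {x : ℝ} (hx : x ∈ O) (i : ℕ) :
    HasDerivAt (iteratedDeriv i f) (iteratedDeriv (i + 1) f x) x := by
  rw [iteratedDeriv_succ]
  exact ((contDiffAt_iteratedDeriv (hf.contDiffAt (hO.mem_nhds hx)) i).differentiableAt
    (by simp)).hasDerivAt

theorem applyL_airyComb {O : Set ℝ} (hO : IsOpen O) {f g : ℝ → ℂ}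
    (hf : ContDiffOn ℝ (⊤ : ℕ∞) f O) (hg : ContDiffOn ℝ (⊤ : ℕ∞) g O) (u₁ u₀ : ℝ → ℂ)
    {t : ℝ} (ht : 0 < t) {x : ℝ} (hx : x ∈ O) (y : ℝ) {c k : ℂ}
    (hc : c = ((x : ℂ) - y) / (3 * t)) (hk : k = 1 / (3 * t)) :
    applyL u₁ u₀ (fun ξ => f ξ * airyTerm 0 ξ y t + g ξ * airyTerm 1 ξ y t) x =
      (iteratedDeriv 3 f x - 3 * k * iteratedDeriv 1 g x - 3 * c * iteratedDeriv 2 g x - k * f x -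
        3 * c * iteratedDeriv 1 f x + c ^ 2 * g x + u₁ x * (iteratedDeriv 1 f x - c * g x) +
        u₀ x * f x) * airyTerm 0 x y t +
      (3 * iteratedDeriv 2 f x + iteratedDeriv 3 g x - 2 * k * g x - 3 * c * iteratedDeriv 1 g x -
        c * f x + u₁ x * (f x + iteratedDeriv 1 g x) + u₀ x * g x) * airyTerm 1 x y t := by
  have hF : ∀ ξ ∈ O, ∀ i, HasDerivAt (iteratedDeriv i f) (iteratedDeriv (i + 1) f ξ) ξ :=
    fun ξ hξ i => hasDerivAt_iteratedDeriv hO hf hξ i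
  have hG : ∀ ξ ∈ O, ∀ i, HasDerivAt (iteratedDeriv i g) (iteratedDeriv (i + 1) g ξ) ξ :=
    fun ξ hξ i => hasDerivAt_iteratedDeriv hO hg hξ i
  have hC : ∀ ξ : ℝ, HasDerivAt (fun ξ : ℝ => ((ξ : ℂ) - y) / (3 * t)) (1 / (3 * t)) ξ := fun ξ =>
    ((Complex.ofRealCLM.hasDerivAt (x := ξ)).sub_const (y : ℂ)).div_const _
  have hF0 : ∀ ξ ∈ O, HasDerivAt f (iteratedDeriv 1 f ξ) ξ := fun ξ hξ => by
    simpa using hF ξ hξ 0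
  have hG0 : ∀ ξ ∈ O, HasDerivAt g (iteratedDeriv 1 g ξ) ξ := fun ξ hξ => by
    simpa using hG ξ hξ 0
  set v : ℝ → ℂ := fun ξ => f ξ * airyTerm 0 ξ y t + g ξ * airyTerm 1 ξ y t with hv
  let v₁ : ℝ → ℂ := fun ξ =>
    (iteratedDeriv 1 f ξ - ((ξ : ℂ) - y) / (3 * t) * g ξ) * airyTerm 0 ξ y t +
      (f ξ + iteratedDeriv 1 g ξ) * airyTerm 1 ξ y t
  let v₂ : ℝ → ℂ := fun ξ =>
    (iteratedDeriv 2 f ξ - 1 / (3 * t) * g ξ - ((ξ : ℂ) - y) / (3 * t) * iteratedDeriv 1 g ξ -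
      ((ξ : ℂ) - y) / (3 * t) * (f ξ + iteratedDeriv 1 g ξ)) * airyTerm 0 ξ y t +
    (iteratedDeriv 1 f ξ - ((ξ : ℂ) - y) / (3 * t) * g ξ +
      (iteratedDeriv 1 f ξ + iteratedDeriv 2 g ξ)) * airyTerm 1 ξ y t
  have h1 : ∀ ξ ∈ O, deriv v ξ = v₁ ξ := fun ξ hξ =>
    (hasDerivAt_airyComb ht (hF0 ξ hξ) (hG0 ξ hξ)).deriv
  have h2 : ∀ ξ ∈ O, deriv v₁ ξ = v₂ ξ := fun ξ hξ => by
    refine (hasDerivAt_airyComb ht ((hF ξ hξ 1).fun_sub ((hC ξ).fun_mul (hG0 ξ hξ)))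
      ((hF0 ξ hξ).fun_add (hG ξ hξ 1))).deriv.trans ?_
    simp only [v₂]; ring
  have h3 := (hasDerivAt_airyComb (y := y) ht
    ((((hF x hx 2).fun_sub ((hG0 x hx).const_mul (1 / (3 * (t : ℂ))))).fun_sub
      ((hC x).fun_mul (hG x hx 1))).fun_sub
        ((hC x).fun_mul ((hF0 x hx).fun_add (hG x hx 1))))
    (((hF x hx 1).fun_sub ((hC x).fun_mul (hG0 x hx))).fun_add
      ((hF x hx 1).fun_add (hG x hx 2)))).deriv
  change deriv v₂ x = _ at h3
  have e1 : ∀ ξ ∈ O, deriv (deriv v) ξ = v₂ ξ := fun ξ hξ => by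
    rw [← h2 ξ hξ]
    refine EventuallyEq.deriv_eq ?_
    filter_upwards [hO.mem_nhds hξ] with ζ hζ using h1 ζ hζ
  have e2 : iteratedDeriv 3 v x = deriv v₂ x := by
    rw [iteratedDeriv_succ, iteratedDeriv_succ, iteratedDeriv_one]
    refine EventuallyEq.deriv_eq ?_
    filter_upwards [hO.mem_nhds hx] with ζ hζ using e1 ζ hζ
  rw [applyL, e2, h3, h1 x hx]
  simp only [v₁, hv]
  rw [hc, hk]
  ring

/-- The operator applied to the amplitudes of the heat kernel expansion: `airyTerm 0` part. -/
def recLeftZero (u₁ : ℝ → ℂ) (y : ℝ) (k : ℕ) (f g : ℝ → ℂ) (x : ℝ) : ℂ :=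
  k * f x + ((x : ℂ) - y) * deriv f x + ((x : ℂ) - y) * deriv (deriv g) x + deriv g x +
    1 / 3 * (((x : ℂ) - y) * (u₁ x * g x))

/-- The operator applied to the amplitudes of the heat kernel expansion: `airyTerm 1` part. -/
def recLeftOne (y : ℝ) (k : ℕ) (g : ℝ → ℂ) (x : ℝ) : ℂ :=
  k * g x + ((x : ℂ) - y) * deriv g x

/-- The source in the recursion for the amplitude of `airyTerm 1`. -/
def recRightOne (u₁ u₀ f g : ℝ → ℂ) (x : ℝ) : ℂ :=
  applyL u₁ u₀ g x + 3 * deriv (deriv f) x + u₁ x * f x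

/-- The factor `t` clears the denominators created by differentiating the Airy terms. The terms in
`(x - y)² / t` from `∂_t` and `∂_x³` cancel, so the coefficients become polynomials in `t`. -/
theorem heat_residual {O : Set ℝ} (hO : IsOpen O) {n : ℕ} {a b : ℕ → ℝ → ℂ}
    (ha : ∀ k ≤ n, ContDiffOn ℝ (⊤ : ℕ∞) (a k) O) (hb : ∀ k ≤ n, ContDiffOn ℝ (⊤ : ℕ∞) (b k) O)
    (u₁ u₀ : ℝ → ℂ) {t : ℝ} (ht : 0 < t) {x : ℝ} (hx : x ∈ O) (y : ℝ) :
    t * (deriv (fun τ : ℝ => (∑ k ∈ range (n + 1), a k x * (τ : ℂ) ^ k) * airyTerm 0 x y τ +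
        (∑ k ∈ range (n + 1), b k x * (τ : ℂ) ^ k) * airyTerm 1 x y τ) t -
      applyL u₁ u₀ (fun ξ => (∑ k ∈ range (n + 1), a k ξ * (t : ℂ) ^ k) * airyTerm 0 ξ y t +
        (∑ k ∈ range (n + 1), b k ξ * (t : ℂ) ^ k) * airyTerm 1 ξ y t) x) =
    (∑ k ∈ range (n + 1), recLeftZero u₁ y k (a k) (b k) x * (t : ℂ) ^ k -
      ∑ k ∈ range (n + 1), applyL u₁ u₀ (a k) x * (t : ℂ) ^ (k + 1)) * airyTerm 0 x y t +
    (∑ k ∈ range (n + 1), recLeftOne y k (b k) x * (t : ℂ) ^ k -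
      ∑ k ∈ range (n + 1), recRightOne u₁ u₀ (a k) (b k) x * (t : ℂ) ^ (k + 1)) *
        airyTerm 1 x y t := by
  have ht0 : (t : ℂ) ≠ 0 := by exact_mod_cast ht.ne'
  have smooth : ∀ c : ℕ → ℝ → ℂ, (∀ k ≤ n, ContDiffOn ℝ (⊤ : ℕ∞) (c k) O) →
      ContDiffOn ℝ (⊤ : ℕ∞) (fun ξ => ∑ k ∈ range (n + 1), c k ξ * (t : ℂ) ^ k) O := fun c hc =>
    ContDiffOn.sum fun k hk => (hc k (by rw [mem_range] at hk; omega)).mul contDiffOn_const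
  have itd : ∀ c : ℕ → ℝ → ℂ, (∀ k ≤ n, ContDiffOn ℝ (⊤ : ℕ∞) (c k) O) → ∀ i : ℕ,
      iteratedDeriv i (fun ξ => ∑ k ∈ range (n + 1), c k ξ * (t : ℂ) ^ k) x =
        ∑ k ∈ range (n + 1), iteratedDeriv i (c k) x * (t : ℂ) ^ k := fun c hc i => by
    rw [iteratedDeriv_fun_sum]
    · exact Finset.sum_congr rfl fun k _ => iteratedDeriv_mul_const_field _ _
    · intro k hk
      rw [mem_range] at hk
      exact ((((hc k (by omega)).contDiffAt (hO.mem_nhds hx))).mul contDiffAt_const).of_le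
        (by exact_mod_cast le_top)
  have tder : ∀ c : ℕ → ℂ, ∃ d : ℂ,
      HasDerivAt (fun τ : ℝ => ∑ k ∈ range (n + 1), c k * (τ : ℂ) ^ k) d t ∧
        t * d = ∑ k ∈ range (n + 1), k * c k * (t : ℂ) ^ k := fun c => by
    refine ⟨∑ k ∈ range (n + 1), c k * (k * (t : ℂ) ^ (k - 1) * 1), ?_, ?_⟩
    · refine HasDerivAt.fun_sum fun k _ => ?_
      exact ((Complex.ofRealCLM.hasDerivAt (x := t)).fun_pow k).const_mul (c k)
    · rw [mul_sum]
      refine Finset.sum_congr rfl fun k _ => ?_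
      rcases k with _ | k
      · simp
      · rw [Nat.add_sub_cancel, pow_succ]; ring
  obtain ⟨da, hda, ea⟩ := tder fun k => a k x
  obtain ⟨db, hdb, eb⟩ := tder fun k => b k x
  rw [((hda.fun_mul (hasDerivAt_airyTerm_zero_time ht x y)).fun_add
    (hdb.fun_mul (hasDerivAt_airyTerm_one_time ht x y))).deriv,
    applyL_airyComb hO (smooth a ha) (smooth b hb) u₁ u₀ ht hx y rfl rfl,
    itd a ha, itd a ha, itd a ha, itd b hb, itd b hb, itd b hb]
  have r1 : ∑ k ∈ range (n + 1), recLeftZero u₁ y k (a k) (b k) x * (t : ℂ) ^ k =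
      t * da + ((x : ℂ) - y) * ∑ k ∈ range (n + 1), iteratedDeriv 1 (a k) x * (t : ℂ) ^ k +
      ((x : ℂ) - y) * ∑ k ∈ range (n + 1), iteratedDeriv 2 (b k) x * (t : ℂ) ^ k +
      ∑ k ∈ range (n + 1), iteratedDeriv 1 (b k) x * (t : ℂ) ^ k +
      1 / 3 * ((x : ℂ) - y) * u₁ x * ∑ k ∈ range (n + 1), b k x * (t : ℂ) ^ k := by
    rw [ea]
    simp only [mul_sum, ← sum_add_distrib, recLeftZero, iteratedDeriv_succ, iteratedDeriv_zero]
    exact Finset.sum_congr rfl fun k _ => by ring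
  have r2 : ∑ k ∈ range (n + 1), applyL u₁ u₀ (a k) x * (t : ℂ) ^ (k + 1) =
      t * (∑ k ∈ range (n + 1), iteratedDeriv 3 (a k) x * (t : ℂ) ^ k +
        u₁ x * ∑ k ∈ range (n + 1), iteratedDeriv 1 (a k) x * (t : ℂ) ^ k +
        u₀ x * ∑ k ∈ range (n + 1), a k x * (t : ℂ) ^ k) := by
    simp only [mul_sum, ← sum_add_distrib, applyL, iteratedDeriv_one]
    exact Finset.sum_congr rfl fun k _ => by ring
  have r3 : ∑ k ∈ range (n + 1), recLeftOne y k (b k) x * (t : ℂ) ^ k =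
      t * db + ((x : ℂ) - y) * ∑ k ∈ range (n + 1), iteratedDeriv 1 (b k) x * (t : ℂ) ^ k := by
    rw [eb]
    simp only [mul_sum, ← sum_add_distrib, recLeftOne, iteratedDeriv_one]
    exact Finset.sum_congr rfl fun k _ => by ring
  have r4 : ∑ k ∈ range (n + 1), recRightOne u₁ u₀ (a k) (b k) x * (t : ℂ) ^ (k + 1) =
      t * (∑ k ∈ range (n + 1), iteratedDeriv 3 (b k) x * (t : ℂ) ^ k +
        u₁ x * ∑ k ∈ range (n + 1), iteratedDeriv 1 (b k) x * (t : ℂ) ^ k +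
        u₀ x * ∑ k ∈ range (n + 1), b k x * (t : ℂ) ^ k +
        3 * ∑ k ∈ range (n + 1), iteratedDeriv 2 (a k) x * (t : ℂ) ^ k +
        u₁ x * ∑ k ∈ range (n + 1), a k x * (t : ℂ) ^ k) := by
    have i2 : iteratedDeriv 2 = fun f : ℝ → ℂ => deriv (deriv f) := by
      ext f; rw [iteratedDeriv_succ, iteratedDeriv_one]
    simp only [mul_sum, ← sum_add_distrib, recRightOne, applyL, iteratedDeriv_one, i2]
    exact Finset.sum_congr rfl fun k _ => by ring
  rw [r1, r2, r3, r4]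
  field_simp
  ring

end Boussinesq

end

/-! ### From the formal heat equation to the recursion for Taylor series on the diagonal -/

noncomputable section

namespace Boussinesq

open Filter Topology Finset

/-- The Hadamard coefficients, extended to `k = 0` by the coefficients of the leading term. -/
def hadamardExt (H : ℕ → Fin 2 → ℝ → ℝ → ℂ) (k : ℕ) (j : Fin 2) (x y : ℝ) : ℂ :=
  if k = 0 then (if j = 0 then 1 else 0) else H k j x y

theorem heatPartialSum_eq (H : ℕ → Fin 2 → ℝ → ℝ → ℂ) (n : ℕ) (x y t : ℝ) :
    heatPartialSum H n x y t =
      (∑ k ∈ range (n + 1), hadamardExt H k 0 x y * (t : ℂ) ^ k) * airyTerm 0 x y t +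
      (∑ k ∈ range (n + 1), hadamardExt H k 1 x y * (t : ℂ) ^ k) * airyTerm 1 x y t := by
  have e : ∀ f : ℕ → ℂ, ∑ k ∈ Icc 1 n, f k = ∑ k ∈ range n, f (k + 1) := fun f => by
    induction n with
    | zero => simp
    | succ n ih => rw [Finset.sum_Icc_succ_top (by omega), ih, Finset.sum_range_succ]
  rw [heatPartialSum, Fin.sum_univ_two, e, e, Finset.sum_range_succ', Finset.sum_range_succ']
  simp [hadamardExt]
  ring

/-- This compares the coefficients of `t ^ (n + 1)` in `t` times the residual. The allowed error
sits at `t ^ (n + 2)` and does not interfere. -/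
theorem hadamard_recursion_off_diagonal {O : Set ℝ} (hO : IsOpen O) {n : ℕ} {a b : ℕ → ℝ → ℂ}
    (ha : ∀ k ≤ n + 1, ContDiffOn ℝ (⊤ : ℕ∞) (a k) O)
    (hb : ∀ k ≤ n + 1, ContDiffOn ℝ (⊤ : ℕ∞) (b k) O) {u₁ u₀ : ℝ → ℂ} {x y : ℝ} (hx : x ∈ O)
    (hxy : x ≠ y) {r₀ r₁ : ℂ}
    (h : ∀ t : ℝ, 0 < t →
      deriv (fun τ : ℝ => (∑ k ∈ range (n + 1 + 1), a k x * (τ : ℂ) ^ k) * airyTerm 0 x y τ +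
        (∑ k ∈ range (n + 1 + 1), b k x * (τ : ℂ) ^ k) * airyTerm 1 x y τ) t -
      applyL u₁ u₀ (fun ξ => (∑ k ∈ range (n + 1 + 1), a k ξ * (t : ℂ) ^ k) * airyTerm 0 ξ y t +
        (∑ k ∈ range (n + 1 + 1), b k ξ * (t : ℂ) ^ k) * airyTerm 1 ξ y t) x =
      r₀ * airyTerm 0 x y t * (t : ℂ) ^ (n + 1) + r₁ * airyTerm 1 x y t * (t : ℂ) ^ (n + 1)) :
    recLeftZero u₁ y (n + 1) (a (n + 1)) (b (n + 1)) x = applyL u₁ u₀ (a n) x ∧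
      recLeftOne y (n + 1) (b (n + 1)) x = recRightOne u₁ u₀ (a n) (b n) x := by
  -- The coefficient of `t ^ k` once the three sums are merged; the sources are shifted by one power
  -- of `t`.
  let γ : (ℕ → ℂ) → (ℕ → ℂ) → ℂ → ℕ → ℂ := fun A B r k =>
    (if k ≤ n + 1 then A k else 0) - (if k = 0 then 0 else B (k - 1)) -
      (if k = n + 2 then r else 0)
  have hγ : ∀ A B r (t : ℂ), ∑ k ∈ range (n + 3), γ A B r k * t ^ k =
      ∑ k ∈ range (n + 1 + 1), A k * t ^ k - ∑ k ∈ range (n + 1 + 1), B k * t ^ (k + 1) -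
        r * t ^ (n + 2) := by
    intro A B r t
    simp only [γ, sub_mul, Finset.sum_sub_distrib]
    congr 2
    · rw [Finset.sum_range_succ, if_neg (by omega), zero_mul, add_zero]
      refine Finset.sum_congr rfl fun k hk => ?_
      rw [mem_range] at hk
      rw [if_pos (by omega)]
    · rw [Finset.sum_range_succ']
      simp
    · rw [Finset.sum_eq_single (n + 2)]
      · simp
      · intro k _ hk; simp [hk]
      · intro hk; simp at hk
  have key := airyTerm_independent hxy (N := n + 3)
    (α := γ (fun k => recLeftZero u₁ y k (a k) (b k) x) (fun k => applyL u₁ u₀ (a k) x) r₀)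
    (β := γ (fun k => recLeftOne y k (b k) x) (fun k => recRightOne u₁ u₀ (a k) (b k) x) r₁)
    (fun t ht => by
      have h1 := heat_residual hO ha hb u₁ u₀ ht hx y
      rw [h t ht] at h1
      have h0 := hγ (fun k => recLeftZero u₁ y k (a k) (b k) x) (fun k => applyL u₁ u₀ (a k) x) r₀ t
      have h2 := hγ (fun k => recLeftOne y k (b k) x)
        (fun k => recRightOne u₁ u₀ (a k) (b k) x) r₁ t
      rw [h0, h2]
      linear_combination -h1) (show n + 1 < n + 3 by omega)
  simpa [γ, sub_eq_zero] using key

/-- At `x = y` the Airy terms do not separate powers of `t` by the scaling argument, so the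
identities are extended there by continuity of both sides. -/
theorem IsHadamard.rec_eventually {U : Set ℝ} (hU : IsOpen U) {u₁ u₀ : ℝ → ℂ}
    (hu₁ : ContDiffOn ℝ (⊤ : ℕ∞) u₁ U) (hu₀ : ContDiffOn ℝ (⊤ : ℕ∞) u₀ U)
    {H : ℕ → Fin 2 → ℝ → ℝ → ℂ} (hH : IsHadamard U u₁ u₀ H) {y : ℝ} (hy : y ∈ U) (n : ℕ) :
    ∃ O : Set ℝ, IsOpen O ∧ y ∈ O ∧
      (∀ k ≤ n + 1, ∀ j, ContDiffOn ℝ (⊤ : ℕ∞) (fun x => hadamardExt H k j x y) O) ∧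
      ∀ x ∈ O,
        recLeftZero u₁ y (n + 1) (fun ξ => hadamardExt H (n + 1) 0 ξ y)
          (fun ξ => hadamardExt H (n + 1) 1 ξ y) x =
            applyL u₁ u₀ (fun ξ => hadamardExt H n 0 ξ y) x ∧
        recLeftOne y (n + 1) (fun ξ => hadamardExt H (n + 1) 1 ξ y) x =
          recRightOne u₁ u₀ (fun ξ => hadamardExt H n 0 ξ y) (fun ξ => hadamardExt H n 1 ξ y) x := by
  obtain ⟨V, hV, hdiag, hsm, r, hr⟩ := hH (n + 1)
  let O : Set ℝ := U ∩ {x | (x, y) ∈ V}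
  have hO : IsOpen O := hU.inter (hV.preimage (by fun_prop : Continuous fun x : ℝ => (x, y)))
  have hyO : y ∈ O := ⟨hy, hdiag y hy⟩
  have hs : ∀ k ≤ n + 1, ∀ j, ContDiffOn ℝ (⊤ : ℕ∞) (fun x => hadamardExt H k j x y) O := by
    intro k hk j
    by_cases h0 : k = 0
    · subst h0; simp only [hadamardExt, if_true]; exact contDiffOn_const
    · simp only [hadamardExt, if_neg h0]
      exact (hsm k (by rw [mem_Icc]; omega) j).comp
        (contDiff_id.prodMk contDiff_const).contDiffOn fun x hx => hx.2
  refine ⟨O, hO, hyO, hs, ?_⟩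
  have off : ∀ x ∈ O, x ≠ y → _ := fun x hx hxy =>
    hadamard_recursion_off_diagonal hO (a := fun k ξ => hadamardExt H k 0 ξ y)
      (b := fun k ξ => hadamardExt H k 1 ξ y) (fun k hk => hs k hk 0) (fun k hk => hs k hk 1)
      (u₁ := u₁) (u₀ := u₀) hx hxy (r₀ := r 0 x y) (r₁ := r 1 x y) (fun t ht => by
        have := hr x y hx.2 t ht
        simp only [heatPartialSum_eq, Fin.sum_univ_two] at this
        exact this)
  have sU : ∀ {u : ℝ → ℂ}, ContDiffOn ℝ (⊤ : ℕ∞) u U → ContDiffAt ℝ (⊤ : ℕ∞) u y := fun hu =>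
    hu.contDiffAt (hU.mem_nhds hy)
  have s0 : ∀ k ≤ n + 1, ∀ j i, ContinuousAt (iteratedDeriv i fun x => hadamardExt H k j x y) y :=
    fun k hk j i =>
      (contDiffAt_iteratedDeriv ((hs k hk j).contDiffAt (hO.mem_nhds hyO)) i).continuousAt
  have ext : ∀ {F G : ℝ → ℂ}, ContinuousAt F y → ContinuousAt G y →
      (∀ x ∈ O, x ≠ y → F x = G x) → F y = G y := by
    intro F G hF hG hFG
    refine tendsto_nhds_unique (f := F) (l := 𝓝[≠] y) (hF.tendsto.mono_left nhdsWithin_le_nhds)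
      ((hG.tendsto.mono_left nhdsWithin_le_nhds).congr' ?_)
    filter_upwards [mem_nhdsWithin_of_mem_nhds (hO.mem_nhds hyO), self_mem_nhdsWithin] with x hx hxy
    exact (hFG x hx hxy).symm
  have c1 := (sU hu₁).continuousAt
  have c0 := (sU hu₀).continuousAt
  have cz : ContinuousAt (fun x : ℝ => (x : ℂ) - y) y := by fun_prop
  have cd : ∀ k ≤ n + 1, ∀ j, ContinuousAt (fun x => hadamardExt H k j x y) y ∧
      ContinuousAt (deriv fun x => hadamardExt H k j x y) y ∧
      ContinuousAt (deriv (deriv fun x => hadamardExt H k j x y)) y ∧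
      ContinuousAt (iteratedDeriv 3 fun x => hadamardExt H k j x y) y := fun k hk j => by
    have h0 := s0 k hk j 0
    have h1 := s0 k hk j 1
    have h2 := s0 k hk j 2
    rw [iteratedDeriv_zero] at h0
    rw [iteratedDeriv_one] at h1
    rw [iteratedDeriv_succ, iteratedDeriv_one] at h2
    exact ⟨h0, h1, h2, s0 k hk j 3⟩
  intro x hx
  by_cases hxy : x = y
  · subst hxy
    obtain ⟨a0, a1, a2, a3⟩ := cd n (by omega) 0
    obtain ⟨b0, b1, b2, b3⟩ := cd n (by omega) 1
    obtain ⟨a0', a1', a2', a3'⟩ := cd (n + 1) (by omega) 0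
    obtain ⟨b0', b1', b2', b3'⟩ := cd (n + 1) (by omega) 1
    constructor
    · refine ext ?_ ?_ fun x hx hxy => (off x hx hxy).1
      · unfold recLeftZero
        exact ((((continuousAt_const.mul a0').add (cz.mul a1')).add (cz.mul b2')).add b1').add
          (continuousAt_const.mul (cz.mul (c1.mul b0')))
      · unfold applyL
        exact (a3.add (c1.mul a1)).add (c0.mul a0)
    · refine ext ?_ ?_ fun x hx hxy => (off x hx hxy).2
      · unfold recLeftOne
        exact (continuousAt_const.mul b0').add (cz.mul b1')
      · unfold recRightOne applyL
        exact (((b3.add (c1.mul b1)).add (c0.mul b0)).add (continuousAt_const.mul a2)).add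
          (c1.mul a0)
  · exact off x hx hxy

theorem jet_applyL {u₁ u₀ f : ℝ → ℂ} {y : ℝ} (hu₁ : ContDiffAt ℝ (⊤ : ℕ∞) u₁ y)
    (hu₀ : ContDiffAt ℝ (⊤ : ℕ∞) u₀ y) (hf : ContDiffAt ℝ (⊤ : ℕ∞) f y) :
    jet y (applyL u₁ u₀ f) = serL (jet y u₁) (jet y u₀) (jet y f) := by
  have h3 := contDiffAt_iteratedDeriv hf 3
  have h1 := contDiffAt_deriv hf
  change jet y (fun x => iteratedDeriv 3 f x + u₁ x * deriv f x + u₀ x * f x) = _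
  rw [jet_add (h3.add (hu₁.mul h1)) (hu₀.mul hf), jet_add h3 (hu₁.mul h1), jet_mul hu₁ h1,
    jet_mul hu₀ hf, jet_iteratedDeriv, jet_deriv]
  rfl

theorem IsHadamard.hadamardRec {U : Set ℝ} (hU : IsOpen U) {u₁ u₀ : ℝ → ℂ}
    (hu₁ : ContDiffOn ℝ (⊤ : ℕ∞) u₁ U) (hu₀ : ContDiffOn ℝ (⊤ : ℕ∞) u₀ U)
    {H : ℕ → Fin 2 → ℝ → ℝ → ℂ} (hH : IsHadamard U u₁ u₀ H) {y : ℝ} (hy : y ∈ U) :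
    HadamardRec (jet y u₁) (jet y u₀) (fun k => jet y fun x => hadamardExt H k 0 x y)
      (fun k => jet y fun x => hadamardExt H k 1 x y) := by
  have sU₁ := hu₁.contDiffAt (hU.mem_nhds hy)
  have sU₀ := hu₀.contDiffAt (hU.mem_nhds hy)
  have sz : ContDiffAt ℝ (⊤ : ℕ∞) (fun x : ℝ => (x : ℂ) - y) y :=
    (Complex.ofRealCLM.contDiff.sub contDiff_const).contDiffAt
  refine ⟨?_, ?_, fun n => ?_, fun n => ?_⟩
  · simp only [hadamardExt, if_true, jet_const, map_one]
  · simp only [hadamardExt, if_true, one_ne_zero, if_false, jet_const, map_zero]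
  · obtain ⟨O, hO, hyO, hs, hrec⟩ := hH.rec_eventually hU hu₁ hu₀ hy n
    have sm : ∀ k ≤ n + 1, ∀ j, ContDiffAt ℝ (⊤ : ℕ∞) (fun x => hadamardExt H k j x y) y :=
      fun k hk j => (hs k hk j).contDiffAt (hO.mem_nhds hyO)
    rw [← jet_applyL sU₁ sU₀ (sm n (by omega) 0)]
    have e : jet y (recLeftZero u₁ y (n + 1) (fun ξ => hadamardExt H (n + 1) 0 ξ y)
          (fun ξ => hadamardExt H (n + 1) 1 ξ y)) =
        jet y (applyL u₁ u₀ (fun ξ => hadamardExt H n 0 ξ y)) := by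
      refine jet_congr ?_
      filter_upwards [hO.mem_nhds hyO] with x hx using (hrec x hx).1
    rw [← e]
    have sa := sm (n + 1) le_rfl 0
    have sb := sm (n + 1) le_rfl 1
    generalize (fun ξ => hadamardExt H (n + 1) 0 ξ y) = f at sa ⊢
    generalize (fun ξ => hadamardExt H (n + 1) 1 ξ y) = g at sb ⊢
    have t1 := (contDiffAt_const (c := ((n + 1 : ℕ) : ℂ))).mul sa
    have t2 := sz.mul (contDiffAt_deriv sa)
    have t3 := sz.mul (contDiffAt_deriv (contDiffAt_deriv sb))
    have t4 := contDiffAt_deriv sb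
    have t5 := sz.mul (sU₁.mul sb)
    unfold recLeftZero
    rw [jet_add (((t1.add t2).add t3).add t4) (contDiffAt_const.mul t5),
      jet_add ((t1.add t2).add t3) t4, jet_add (t1.add t2) t3, jet_add t1 t2,
      jet_mul contDiffAt_const sa, jet_mul sz (contDiffAt_deriv sa),
      jet_mul sz (contDiffAt_deriv (contDiffAt_deriv sb)), jet_mul contDiffAt_const t5,
      jet_mul sz (sU₁.mul sb), jet_mul sU₁ sb, jet_ofReal_sub, jet_const, jet_const, jet_deriv,
      jet_deriv, jet_deriv, PowerSeries.smul_eq_C_mul, PowerSeries.smul_eq_C_mul]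
    push_cast
    rfl
  · obtain ⟨O, hO, hyO, hs, hrec⟩ := hH.rec_eventually hU hu₁ hu₀ hy n
    have sm : ∀ k ≤ n + 1, ∀ j, ContDiffAt ℝ (⊤ : ℕ∞) (fun x => hadamardExt H k j x y) y :=
      fun k hk j => (hs k hk j).contDiffAt (hO.mem_nhds hyO)
    have e : jet y (recLeftOne y (n + 1) (fun ξ => hadamardExt H (n + 1) 1 ξ y)) =
        jet y (recRightOne u₁ u₀ (fun ξ => hadamardExt H n 0 ξ y)
          (fun ξ => hadamardExt H n 1 ξ y)) := by
      refine jet_congr ?_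
      filter_upwards [hO.mem_nhds hyO] with x hx using (hrec x hx).2
    have sb := sm (n + 1) le_rfl 1
    have sa' := sm n (by omega) 0
    have sb' := sm n (by omega) 1
    generalize (fun ξ => hadamardExt H (n + 1) 1 ξ y) = g at sb e ⊢
    generalize (fun ξ => hadamardExt H n 0 ξ y) = f' at sa' e ⊢
    generalize (fun ξ => hadamardExt H n 1 ξ y) = g' at sb' e ⊢
    have t1 := (contDiffAt_const (c := ((n + 1 : ℕ) : ℂ))).mul sb
    have t2 := contDiffAt_deriv (contDiffAt_deriv sa')
    have t0 : ContDiffAt ℝ (⊤ : ℕ∞) (applyL u₁ u₀ g') y :=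
      ((contDiffAt_iteratedDeriv sb' 3).add (sU₁.mul (contDiffAt_deriv sb'))).add (sU₀.mul sb')
    unfold recLeftOne recRightOne at e
    rw [jet_add t1 (sz.mul (contDiffAt_deriv sb)), jet_mul contDiffAt_const sb,
      jet_mul sz (contDiffAt_deriv sb), jet_add (t0.add (contDiffAt_const.mul t2)) (sU₁.mul sa'),
      jet_add t0 (contDiffAt_const.mul t2), jet_mul contDiffAt_const t2, jet_mul sU₁ sa',
      jet_applyL sU₁ sU₀ sb', jet_ofReal_sub, jet_const, jet_const, jet_deriv, jet_deriv,
      jet_deriv, map_ofNat] at e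
    rw [← e, PowerSeries.smul_eq_C_mul]
    push_cast
    rfl

end Boussinesq

end

/-! ### The flow in terms of residues, and conclusion -/

noncomputable section

namespace Boussinesq

open Filter Topology PowerSeries

theorem opL_coeffAt (u₁ u₀ : ℝ → ℂ) (n : ℤ) (x : ℝ) :
    (opL u₁ u₀).coeffAt n x =
      if n = 1 then u₁ x else if n = 0 then u₀ x else if n = 3 then 1 else 0 := by
  rw [PsiDO.coeffAt, show (opL u₁ u₀).order = 3 from rfl]
  by_cases hn : n ≤ 3
  · rw [if_pos hn]
    simp only [opL]
    split_ifs <;> first | rfl | omega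
  · rw [if_neg hn, if_neg (by omega), if_neg (by omega), if_neg (by omega)]

/-- The flow `∂ L / ∂ s_m = [(L ^ (m / 3))_+, L]` only depends on the coefficients of `∂_x ^ (-1)`
and `∂_x ^ (-2)` of `L ^ (m / 3)`. -/
theorem gelfandDickeyFlow_iff {Ω : Set (ℝ × (ℕ → ℝ))} {u₁ u₀ : (ℕ → ℝ) → ℝ → ℂ} {s : ℕ → ℝ}
    (hU : IsOpen (slice Ω s)) (hu₁ : ContDiffOn ℝ (⊤ : ℕ∞) (u₁ s) (slice Ω s))
    (hu₀ : ContDiffOn ℝ (⊤ : ℕ∞) (u₀ s) (slice Ω s)) {m : ℕ} {ρ₁ ρ₂ : ℝ → ℂ}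
    (hρ : ∀ P, PsiDO.IsCubeRoot (slice Ω s) P (opL (u₁ s) (u₀ s)) → ∀ y ∈ slice Ω s,
      (P.pow m).coeff (m + 1) y = ρ₁ y ∧
        deriv ((P.pow m).coeff (m + 1)) y + (P.pow m).coeff (m + 2) y = ρ₂ y) :
    GelfandDickeyFlow Ω u₁ u₀ m s ↔ ∀ x ∈ slice Ω s,
      HasTimeDeriv (fun s' => u₁ s' x) m s (3 * deriv ρ₁ x) ∧
        HasTimeDeriv (fun s' => u₀ s' x) m s (3 * deriv ρ₂ x) := by
  have comm : ∀ P, PsiDO.IsCubeRoot (slice Ω s) P (opL (u₁ s) (u₀ s)) → ∀ x ∈ slice Ω s,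
      ∀ n : ℤ, PsiDO.commCoeff (P.pow m).posPart (opL (u₁ s) (u₀ s)) n x =
        if n = 1 then 3 * deriv ρ₁ x else if n = 0 then 3 * deriv ρ₂ x else 0 := by
    intro P hP x hx n
    have e₁ : (P.pow m).coeff (m + 1) =ᶠ[𝓝 x] ρ₁ := by
      filter_upwards [hU.mem_nhds hx] with y hy using (hρ P hP y hy).1
    have e₂ : (fun ξ => deriv ((P.pow m).coeff (m + 1)) ξ + (P.pow m).coeff (m + 2) ξ)
        =ᶠ[𝓝 x] ρ₂ := by
      filter_upwards [hU.mem_nhds hx] with y hy using (hρ P hP y hy).2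
    rw [hP.commCoeff_posPart hU hu₁ hu₀ m n hx, e₁.deriv_eq, e₂.deriv_eq]
  constructor
  · rintro ⟨P, hP, h⟩ x hx
    have h₁ := h x hx 1
    have h₀ := h x hx 0
    rw [comm P hP x hx] at h₁ h₀
    simp only [opL_coeffAt, if_true, if_neg (show ¬ (0 : ℤ) = 1 by omega)] at h₁ h₀
    exact ⟨h₁, h₀⟩
  · intro h
    -- The flow asserts the existence of a cube root, so one must be constructed here; the residues
    -- are the same for every choice.
    obtain ⟨P, hP⟩ := PsiDO.exists_isCubeRoot hU hu₁ hu₀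
    refine ⟨P, hP, fun x hx n => ?_⟩
    rw [comm P hP x hx]
    simp only [opL_coeffAt]
    split_ifs
    · exact (h x hx).1
    · exact (h x hx).2
    · exact hasDerivAt_const _ _
    · exact hasDerivAt_const _ _

theorem PsiDO.IsCubeRoot.coeff_pow_eq {U : Set ℝ} {P : PsiDO} {u₁ u₀ : ℝ → ℂ}
    (h : PsiDO.IsCubeRoot U P (opL u₁ u₀)) (hU : IsOpen U) {y : ℝ} (hy : y ∈ U) (m i : ℕ) :
    (P.pow m).coeff i y = constantCoeff (PowerSeries.coeff i (seqPow (jetSeq y P) m)) := by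
  rw [← PsiDO.jetSeq_pow h.order_eq (h.smoothAt hU hy), PsiDO.coeff_jetSeq, constantCoeff_jet]

theorem PsiDO.IsCubeRoot.deriv_coeff_pow_add {U : Set ℝ} {P : PsiDO} {u₁ u₀ : ℝ → ℂ}
    (h : PsiDO.IsCubeRoot U P (opL u₁ u₀)) (hU : IsOpen U) {y : ℝ} (hy : y ∈ U) (m i j : ℕ) :
    deriv ((P.pow m).coeff i) y + (P.pow m).coeff j y =
      constantCoeff (dz (PowerSeries.coeff i (seqPow (jetSeq y P) m)) +
        PowerSeries.coeff j (seqPow (jetSeq y P) m)) := by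
  rw [map_add, ← h.coeff_pow_eq hU hy, ← PsiDO.jetSeq_pow h.order_eq (h.smoothAt hU hy),
    PsiDO.coeff_jetSeq, ← jet_deriv, constantCoeff_jet]

theorem constantCoeff_dz_jet (y : ℝ) (f : ℝ → ℂ) : constantCoeff (dz (jet y f)) = deriv f y := by
  rw [← jet_deriv, constantCoeff_jet]

end Boussinesq

end

theorem proposition5p3
    (Ω : Set (ℝ × (ℕ → ℝ))) (hΩ : ∀ s, IsOpen (slice Ω s))
    (u₁ u₀ : (ℕ → ℝ) → ℝ → ℂ)
    (hu₁ : ∀ s, ContDiffOn ℝ (⊤ : ℕ∞) (u₁ s) (slice Ω s))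
    (hu₀ : ∀ s, ContDiffOn ℝ (⊤ : ℕ∞) (u₀ s) (slice Ω s))
    (H : (ℕ → ℝ) → ℕ → Fin 2 → ℝ → ℝ → ℂ)
    (hH : ∀ s, IsHadamard (slice Ω s) (u₁ s) (u₀ s) (H s))
    (k : ℕ) (hk : 1 ≤ k) (s : ℕ → ℝ) :
    (GelfandDickeyFlow Ω u₁ u₀ (3 * k - 2) s ↔
      ∀ x ∈ slice Ω s,
        HasTimeDeriv (fun s' => u₁ s' x) (3 * k - 2) s
          (3 * poch (1 / 3) k * deriv (diag (H s k 1)) x) ∧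
        HasTimeDeriv (fun s' => u₀ s' x) (3 * k - 2) s
          (3 * poch (1 / 3) k *
            deriv (fun ξ => diag (H s k 0) ξ + diagDx (H s k 1) ξ) x)) ∧
    (GelfandDickeyFlow Ω u₁ u₀ (3 * k - 1) s ↔
      ∀ x ∈ slice Ω s,
        HasTimeDeriv (fun s' => u₁ s' x) (3 * k - 1) s
          (3 * poch (2 / 3) k * deriv (diag (H s k 0)) x) ∧
        HasTimeDeriv (fun s' => u₀ s' x) (3 * k - 1) s
          (3 * poch (2 / 3) k * deriv (diagDx (H s k 0)) x)) ∧
    (GelfandDickeyFlow Ω u₁ u₀ (3 * k) s ↔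
      ∀ x ∈ slice Ω s,
        HasTimeDeriv (fun s' => u₁ s' x) (3 * k) s 0 ∧
        HasTimeDeriv (fun s' => u₀ s' x) (3 * k) s 0) := by
  have hU := hΩ s
  have hrec := fun y (hy : y ∈ slice Ω s) => (hH s).hadamardRec hU (hu₁ s) (hu₀ s) hy
  have hk0 : k ≠ 0 := by omega
  refine ⟨?_, ?_, ?_⟩
  · rw [gelfandDickeyFlow_iff (ρ₁ := fun ξ => poch (1 / 3) k * diag (H s k 1) ξ)
      (ρ₂ := fun ξ => poch (1 / 3) k * (diag (H s k 0) ξ + diagDx (H s k 1) ξ))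
      hU (hu₁ s) (hu₀ s)]
    · simp only [deriv_const_mul_field, mul_assoc]
    · intro P hP y hy
      have e := (hrec y hy).residues_one_mod_three (hP.coeff_zero_jetSeq hU hy)
        (hP.seqPow_three hU hy) (show (3 * k - 2) + 2 = 3 * k by omega)
      rw [hP.coeff_pow_eq hU hy, hP.deriv_coeff_pow_add hU hy, e.1, e.2]
      simp only [constantCoeff_dz_jet, constantCoeff_jet, hadamardExt, if_neg hk0, diag, diagDx,
        and_self]
  · rw [gelfandDickeyFlow_iff (ρ₁ := fun ξ => poch (2 / 3) k * diag (H s k 0) ξ)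
      (ρ₂ := fun ξ => poch (2 / 3) k * diagDx (H s k 0) ξ) hU (hu₁ s) (hu₀ s)]
    · simp only [deriv_const_mul_field, mul_assoc]
    · intro P hP y hy
      have e := (hrec y hy).residues_two_mod_three (hP.coeff_zero_jetSeq hU hy)
        (hP.seqPow_three hU hy) (show (3 * k - 1) + 1 = 3 * k by omega)
      rw [hP.coeff_pow_eq hU hy, hP.deriv_coeff_pow_add hU hy, e.1, e.2]
      simp only [constantCoeff_dz_jet, constantCoeff_jet, hadamardExt, if_neg hk0, diag, diagDx,
        and_self]
  · rw [gelfandDickeyFlow_iff (ρ₁ := fun _ => 0) (ρ₂ := fun _ => 0) hU (hu₁ s) (hu₀ s)]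
    · simp only [deriv_const, mul_zero]
    · intro P hP y hy
      have e := (hrec y hy).residues_zero_mod_three (hP.coeff_zero_jetSeq hU hy)
        (hP.seqPow_three hU hy) (show 3 * k = 3 * k from rfl)
      rw [hP.coeff_pow_eq hU hy, hP.deriv_coeff_pow_add hU hy]
      exact e
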